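/- Let $n\ge 0$. An $n$-partition (resp. $n$-half-partition) is a vector $\lambda=(\lambda_1\ge\dots\ge\lambda_n\ge 0)$ with all parts in $\mathbb Z$ (resp. all parts in $\tfrac12+\mathbb Z$). A split orthogonal pattern of height $2n$ is an array $z=(z_{i,j})_{1\le i\le 2n,\ 1\le j\le\lceil i/2\rceil}$ such that the odd ends $z_{2i-1,i}$ ($1\le i\le n$) lie in $\tfrac12\mathbb Z_{\ge0}$, the other entries are either all in $\mathbb Z_{\ge0}$ or all in $\tfrac12+\mathbb Z_{\ge 0}$, and $z_{i+1,j+1}\le z_{i,j}\le z_{i+1,j}$ whenever these entries exist. Its shape is the bottom row $(z_{2n,1},\dots,z_{2n,n})$, and its type is $\mathrm{type}(z)_i=\sum_j z_{i,j}-\sum_j z_{i-1,j}$. If $z_{2n,1}$ is an integer (resp. half-integer), the half-integer (resp. integer) entries of $z$ are called atypical; they are odd ends, and $|\mathrm{atyp}(z)|$ denotes their number. For an $n$-partition or $n$-half-partition $\lambda$ and $\beta\in\mathbb C$, the CB-interpolating Schur polynomial is $$\mathrm{trans}_\lambda(x;\beta)=\sum_{z}\beta^{|\mathrm{atyp}(z)|}\prod_{i=1}^n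 x_i^{\mathrm{type}(z)_{2i}-\mathrm{type}(z)_{2i-1}},$$ the sum being over the split orthogonal patterns $z$ of height $2n$ and shape $\lambda$. It is regarded as a formal finite combination of monomials in $x_1,\dots,x_n$ with exponents in $\tfrac12\mathbb Z$; these form an integral domain. Put $D=\det_{1\le i,j\le n}\big(x_j^{n-i+1}-x_j^{-(n-i+1)}\big)$. **Theorem.** One has $D\neq0$, and the following hold, with the quotients taken in the field of fractions. (1) If $\lambda$ is an $n$-partition and $\beta\in\mathbb C$, then $$\mathrm{trans}_\lambda(x;\beta)=\frac{\det_{1\le i,j\le n}\Big(x_j^{\lambda_i+n-i+1}-x_j^{-(\lambda_i+n-i+1)}+\beta\big[x_j^{\lambda_i+n-i}-x_j^{-(\lambda_i+n-i)}\big]\Big)}{D}.$$ (2) If $\lambda$ is an $n$-half-partition and $\beta\in\mathbb C$, then $$\mathrm{trans}_\lambda(x;\beta)=\frac{\det_{1\le i,j\le n}\Big(\big[\beta x_j^{1/2}+x_j^{-1/2}\big]\big[x_j^{\lambda_i+n-i+1/2}-x_j^{-(\lambda_i+n-i+1/2)}\big]\Big)}{D}.$$ (3) For $|\beta|<1$ the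 Koornwinder polynomials $K_\lambda(x;q,t;t_0,t_1,t_2,t_3)$ with $q=t=0$ and $(t_0,t_1,t_2,t_3)=(-\beta,0,0,0)$ exist and are unique, and for every $n$-partition $\lambda$ $$\mathrm{trans}_\lambda(x;\beta)=K_\lambda(x;0,0;-\beta,0,0,0).$$ Here the Koornwinder polynomials are the family $(K_\lambda)$ of complex Laurent polynomials, indexed by $n$-partitions, such that: each $K_\lambda$ is invariant under permutations of the $x_i$ and inversion of any $x_i$; $\langle K_\lambda,K_\mu\rangle=0$ for $\lambda\ne\mu$; for every $n$-partition $\mu$ the coefficient of $x^\mu$ in $K_\lambda$ is $0$ unless $\mu_1+\dots+\mu_k\le\lambda_1+\dots+\lambda_k$ for all $1\le k\le n$; and the coefficient of $x^\lambda$ in $K_\lambda$ is $1$. The form is $$\langle f,g\rangle=\frac1{2^n\,n!\,(2\pi \mathrm i)^n}\int_{\mathbb T^n}f(x)\,g(x^{-1})\,\Delta(x)\prod_{i=1}^n\frac{\mathrm dx_i}{x_i},\qquad \mathbb T^n=\{x\in\mathbb C^n:|x_1|=\dots=|x_n|=1\},$$ with $$\Delta(x)=\prod_{i=1}^n\prod_{\epsilon=\pm1}\frac{(x_i^{2\epsilon};q)_\infty}{\prod_{k=0}^3(t_kx_i^\epsilon;q)_\infty}\prod_{1\le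 i<j\le n}\ \prod_{\epsilon,\delta=\pm1}\frac{(x_i^\epsilon x_j^\delta;q)_\infty}{(t\,x_i^\epsilon x_j^\delta;q)_\infty},\qquad (z;q)_\infty=\prod_{k\ge0}(1-q^kz).$$ -/

import Mathlib

open scoped BigOperators

noncomputable section

namespace CBInterp

/-! ### Partitions and half-partitions -/

/-- An `n`-partition: `λ₁ ≥ ⋯ ≥ λₙ ≥ 0` with integer parts. -/
def IsPartition {n : ℕ} (lam : Fin n → ℚ) : Prop :=
  Antitone lam ∧ ∀ i, ∃ m : ℕ, lam i = m

/-- An `n`-half-partition: `λ₁ ≥ ⋯ ≥ λₙ ≥ 0` with all parts in `1/2 + ℤ`. -/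
def IsHalfPartition {n : ℕ} (lam : Fin n → ℚ) : Prop :=
  Antitone lam ∧ ∀ i, ∃ m : ℕ, lam i = m + 1 / 2

/-! ### Split orthogonal patterns -/

/-- The index set `1 ≤ i ≤ 2n`, `1 ≤ j ≤ ⌈i/2⌉` of a half-triangular array of height `2n`. -/
def InHalfTriangle (n i j : ℕ) : Prop :=
  1 ≤ i ∧ i ≤ 2 * n ∧ 1 ≤ j ∧ j ≤ (i + 1) / 2

/-- A split orthogonal pattern of height `2n`.  An array is a function of two (one-based) indices
that is extended by `0` outside the half-triangle.  The odd ends are the entries `z i j` with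
`i = 2 j - 1`, written `i + 1 = 2 * j`. -/
structure IsSplitOrthogonalPattern (n : ℕ) (z : ℕ → ℕ → ℚ) : Prop where
  eq_zero_outside : ∀ i j, ¬ InHalfTriangle n i j → z i j = 0
  odd_end : ∀ i j, InHalfTriangle n i j → i + 1 = 2 * j → ∃ m : ℕ, z i j = m / 2
  same_kind :
    (∀ i j, InHalfTriangle n i j → i + 1 ≠ 2 * j → ∃ m : ℕ, z i j = m) ∨
    (∀ i j, InHalfTriangle n i j → i + 1 ≠ 2 * j → ∃ m : ℕ, z i j = 1 / 2 + m)
  interlace_left : ∀ i j, InHalfTriangle n i j → InHalfTriangle n (i + 1) (j + 1) →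
    z (i + 1) (j + 1) ≤ z i j
  interlace_right : ∀ i j, InHalfTriangle n i j → InHalfTriangle n (i + 1) j →
    z i j ≤ z (i + 1) j

/-- The split orthogonal patterns of height `2n` whose shape (bottom row) is `λ`. -/
def splitPatterns {n : ℕ} (lam : Fin n → ℚ) : Set (ℕ → ℕ → ℚ) :=
  {z | IsSplitOrthogonalPattern n z ∧ ∀ j : Fin n, z (2 * n) ((j : ℕ) + 1) = lam j}

theorem splitPatterns_finite {n : ℕ} (lam : Fin n → ℚ) : (splitPatterns lam).Finite := by
  obtain ⟨M, hM⟩ : ∃ M : ℕ, ∀ j, lam j ≤ M := by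
    obtain ⟨B, hB⟩ := (Set.finite_range lam).bddAbove
    obtain ⟨M, hM⟩ := exists_nat_ge B
    exact ⟨M, fun j => (hB ⟨j, rfl⟩).trans hM⟩
  let S : Set ℚ := (fun m : ℕ => (m : ℚ) / 2) '' Set.Iic (2 * M)
  have hS : S.Finite := (Set.finite_Iic _).image _
  let F : (ℕ → ℕ → ℚ) → (Fin (2 * n + 1) × Fin (n + 1) → ℚ) := fun z p => z p.1 p.2
  have bound : ∀ z ∈ splitPatterns lam, ∀ d i j, InHalfTriangle n i j → i + d = 2 * n →
      z i j ≤ M := by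
    rintro z ⟨hz, hsh⟩ d
    induction d with
    | zero =>
      intro i j hij hd
      obtain ⟨h1, h2, h3, h4⟩ := hij
      obtain rfl : i = 2 * n := by omega
      have := hsh ⟨j - 1, by omega⟩
      simp only [Nat.sub_add_cancel h3] at this
      rw [this]
      exact hM _
    | succ d ih =>
      intro i j hij hd
      have h' : InHalfTriangle n (i + 1) j := by
        obtain ⟨h1, h2, h3, h4⟩ := hij
        refine ⟨by omega, by omega, h3, by omega⟩
      exact (hz.interlace_right i j hij h').trans (ih (i + 1) j h' (by omega))
  have half : ∀ z ∈ splitPatterns lam, ∀ i j, ∃ m : ℕ, z i j = (m : ℚ) / 2 := by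
    rintro z ⟨hz, -⟩ i j
    by_cases hij : InHalfTriangle n i j
    · by_cases ho : i + 1 = 2 * j
      · exact hz.odd_end i j hij ho
      · rcases hz.same_kind with h | h
        · obtain ⟨m, hm⟩ := h i j hij ho
          exact ⟨2 * m, by rw [hm]; push_cast; ring⟩
        · obtain ⟨m, hm⟩ := h i j hij ho
          exact ⟨2 * m + 1, by rw [hm]; push_cast; ring⟩
    · exact ⟨0, by rw [hz.eq_zero_outside i j hij]; simp⟩
  refine Set.Finite.of_finite_image (f := F) ?_ ?_
  · refine (Set.Finite.pi' (fun _ => hS)).subset ?_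
    rintro _ ⟨z, hz, rfl⟩ p
    obtain ⟨m, hm⟩ := half z hz p.1 p.2
    refine ⟨m, ?_, hm.symm⟩
    have hle : z p.1 p.2 ≤ M := by
      by_cases hij : InHalfTriangle n p.1 p.2
      · exact bound z hz (2 * n - p.1) _ _ hij (by have := hij.2.1; omega)
      · rw [hz.1.eq_zero_outside _ _ hij]; positivity
    rw [hm] at hle
    have : (m : ℚ) ≤ ((2 * M : ℕ) : ℚ) := by push_cast; linarith
    exact_mod_cast this
  · intro z hz w hw h
    funext i j
    by_cases hij : InHalfTriangle n i j
    · obtain ⟨h1, h2, h3, h4⟩ := hij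
      exact congrFun h (⟨i, by omega⟩, ⟨j, by omega⟩)
    · rw [hz.1.eq_zero_outside i j hij, hw.1.eq_zero_outside i j hij]

/-- The entry `z i j` is atypical: `z (2n) 1` is an integer and `z i j` a half-integer,
or the other way round. -/
def IsAtypical (n : ℕ) (z : ℕ → ℕ → ℚ) (i j : ℕ) : Prop :=
  ((∃ m : ℤ, z (2 * n) 1 = m) ∧ ∃ m : ℤ, z i j = m + 1 / 2) ∨
  ((∃ m : ℤ, z (2 * n) 1 = m + 1 / 2) ∧ ∃ m : ℤ, z i j = m)

open Classical in
/-- The number of atypical entries among the odd ends `z (2i-1) i`, `1 ≤ i ≤ n`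
(all other entries of a split orthogonal pattern are of the kind of `z (2n) 1`). -/
def atypCount (n : ℕ) (z : ℕ → ℕ → ℚ) : ℕ :=
  ((Finset.Icc 1 n).filter fun i => IsAtypical n z (2 * i - 1) i).card

/-- The sum of the `i`-th row; it is `0` for `i = 0`. -/
def rowSum (z : ℕ → ℕ → ℚ) (i : ℕ) : ℚ := ∑ j ∈ Finset.Icc 1 ((i + 1) / 2), z i j

/-- The `i`-th entry of the type of a pattern, `i ≥ 1`. -/
def patternType (z : ℕ → ℕ → ℚ) (i : ℕ) : ℚ := rowSum z i - rowSum z (i - 1)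

/-! ### Laurent polynomials with rational exponents and the interpolating polynomials -/

/-- Formal finite `ℂ`-linear combinations of monomials `x₁^{a₁} ⋯ xₙ^{aₙ}` with rational exponents
(only exponents in `½ ℤ` are used).  It is an integral domain. -/
abbrev FracLaurent (n : ℕ) : Type := AddMonoidAlgebra ℂ (Fin n → ℚ)

/-- The power `x_j ^ a`. -/
def xpow {n : ℕ} (j : Fin n) (a : ℚ) : FracLaurent n :=
  AddMonoidAlgebra.single (Pi.single j a) 1

/-- The CB-interpolating Schur polynomial of shape `λ` with parameter `β`: the sum over split
orthogonal patterns `z` of height `2n` and shape `λ` of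
`β ^ |atyp z| * ∏ᵢ xᵢ ^ (type(z)_{2i} - type(z)_{2i-1})`. -/
def transCB {n : ℕ} (lam : Fin n → ℚ) (β : ℂ) : FracLaurent n :=
  ∑ z ∈ (splitPatterns_finite lam).toFinset,
    β ^ atypCount n z •
      ∏ i : Fin n, xpow i (patternType z (2 * ((i : ℕ) + 1)) - patternType z (2 * ((i : ℕ) + 1) - 1))

/-- The matrix whose determinant is the type C denominator.  Rows and columns are numbered from
`0` in `Fin n`, so `i + 1` is the usual row number. -/
def denomMatrix (n : ℕ) : Matrix (Fin n) (Fin n) (FracLaurent n) :=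
  Matrix.of fun i j =>
    xpow j ((n : ℚ) - ((i : ℕ) + 1) + 1) - xpow j (-((n : ℚ) - ((i : ℕ) + 1) + 1))

/-- The numerator matrix for a partition. -/
def numMatrix {n : ℕ} (lam : Fin n → ℚ) (β : ℂ) : Matrix (Fin n) (Fin n) (FracLaurent n) :=
  Matrix.of fun i j =>
    xpow j (lam i + n - ((i : ℕ) + 1) + 1) - xpow j (-(lam i + n - ((i : ℕ) + 1) + 1))
      + β • (xpow j (lam i + n - ((i : ℕ) + 1)) - xpow j (-(lam i + n - ((i : ℕ) + 1))))

/-- The numerator matrix for a half-partition. -/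
def halfNumMatrix {n : ℕ} (lam : Fin n → ℚ) (β : ℂ) : Matrix (Fin n) (Fin n) (FracLaurent n) :=
  Matrix.of fun i j =>
    (β • xpow j (1 / 2) + xpow j (-(1 / 2))) *
      (xpow j (lam i + n - ((i : ℕ) + 1) + 1 / 2) - xpow j (-(lam i + n - ((i : ℕ) + 1) + 1 / 2)))

/-- The embedding of `FracLaurent n` in its field of fractions. -/
def toFrac {n : ℕ} (f : FracLaurent n) : FractionRing (FracLaurent n) :=
  algebraMap (FracLaurent n) (FractionRing (FracLaurent n)) f

/-! ### Koornwinder polynomials -/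

/-- Laurent polynomials in `n` variables. -/
abbrev Laurent (n : ℕ) : Type := AddMonoidAlgebra ℂ (Fin n → ℤ)

/-- Integer exponents are rational exponents. -/
def Laurent.toFracLaurent {n : ℕ} (f : Laurent n) : FracLaurent n :=
  AddMonoidAlgebra.mapDomain (fun (a : Fin n → ℤ) (i : Fin n) => (a i : ℚ)) f

/-- The value of a Laurent polynomial at `x`. -/
def Laurent.eval {n : ℕ} (f : Laurent n) (x : Fin n → ℂ) : ℂ :=
  f.coeff.sum fun a c => c * ∏ i, x i ^ a i

/-- The `q`-shifted factorial `(z; q)_∞`. -/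
def qPoch (z q : ℂ) : ℂ := ∏' k : ℕ, (1 - q ^ k * z)

/-- The Koornwinder density with parameters `q`, `t` and `t₀, t₁, t₂, t₃`. -/
def koornwinderDensity {n : ℕ} (q t : ℂ) (τ : Fin 4 → ℂ) (x : Fin n → ℂ) : ℂ :=
  (∏ i : Fin n, ∏ ε ∈ ({1, -1} : Finset ℤ),
      qPoch (x i ^ (2 * ε)) q / ∏ k : Fin 4, qPoch (τ k * x i ^ ε) q) *
  ∏ i : Fin n, ∏ j ∈ Finset.Ioi i, ∏ ε ∈ ({1, -1} : Finset ℤ), ∏ δ ∈ ({1, -1} : Finset ℤ),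
      qPoch (x i ^ ε * x j ^ δ) q / qPoch (t * x i ^ ε * x j ^ δ) q

/-- The bilinear form
`⟨f, g⟩ = 1 / (2ⁿ n! (2πi)ⁿ) ∫_{𝕋ⁿ} f(x) g(x⁻¹) Δ(x) ∏ dxᵢ / xᵢ`, where `𝕋ⁿ` is the unit torus. -/
def koornwinderForm {n : ℕ} (q t : ℂ) (τ : Fin 4 → ℂ) (f g : Laurent n) : ℂ :=
  1 / (2 ^ n * (n.factorial : ℂ) * (2 * Real.pi * Complex.I) ^ n) *
    torusIntegral
      (fun x : Fin n → ℂ =>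
        f.eval x * g.eval (fun i => (x i)⁻¹) * koornwinderDensity q t τ x * ∏ i, (x i)⁻¹)
      0 1

/-- Invariance under permutations of the variables and inversion of any of them. -/
def IsBCInvariant {n : ℕ} (f : Laurent n) : Prop :=
  (∀ (σ : Equiv.Perm (Fin n)) (a : Fin n → ℤ), f.coeff (a ∘ σ) = f.coeff a) ∧
  ∀ (i : Fin n) (a : Fin n → ℤ), f.coeff (Function.update a i (-a i)) = f.coeff a

/-- The `n`-partitions, as exponents of monomials. -/
def NPartition (n : ℕ) : Type := {lam : Fin n → ℤ // IsPartition fun i => (lam i : ℚ)}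

/-- The partition, as a vector of rational numbers. -/
def NPartition.toRat {n : ℕ} (lam : NPartition n) : Fin n → ℚ := fun i => (lam.1 i : ℚ)

/-- Dominance order: `μ₁ + ⋯ + μ_k ≤ λ₁ + ⋯ + λ_k` for `1 ≤ k ≤ n`. -/
def NPartition.Dominated {n : ℕ} (mu lam : NPartition n) : Prop :=
  ∀ k : Fin n, ∑ i ∈ Finset.Iic k, mu.1 i ≤ ∑ i ∈ Finset.Iic k, lam.1 i

/-- `K` is the family of Koornwinder polynomials with parameters `q, t; t₀, t₁, t₂, t₃` (all of
modulus `< 1`): BC-invariant, mutually orthogonal, with leading monomial `x ^ λ`. -/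
structure IsKoornwinderFamily {n : ℕ} (q t : ℂ) (τ : Fin 4 → ℂ)
    (K : NPartition n → Laurent n) : Prop where
  invariant : ∀ lam, IsBCInvariant (K lam)
  orthogonal : ∀ lam mu, lam ≠ mu → koornwinderForm q t τ (K lam) (K mu) = 0
  triangular : ∀ lam mu : NPartition n, ¬ mu.Dominated lam → (K lam).coeff mu.1 = 0
  leading : ∀ lam : NPartition n, (K lam).coeff lam.1 = 1

end CBInterp

end

noncomputable section

namespace CBInterp

/-! ### Determinants and telescoping sums -/

/-! The proof rests on one recursion in `n`, satisfied both by the pattern sums and by the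
alternants. Partitions and half-partitions are treated together by writing `λ = a + d/2` with `a`
integral and `d ∈ {0, 1}`.

Removing the last two rows of a pattern of shape `a + d/2` leaves a smaller pattern of shape `b +
d/2`. The removed odd row is `c + d/2`, with its end lowered by `s/2`, where `s = 1` means atypical;
the interlacing conditions say exactly that `c` interlaces `a` and that `b` interlaces `c`. With `y`
the last variable, the sum over `s` gives the weight `1 + βy`, or `1` when `c` ends in `0` and `d =
0`, because the odd end cannot be negative (`patternSum_branching`).

On the determinant side, rescale row `k` by `y^(1-k)`. Consecutive row differences telescope into
sums over `c`. In these, the column of `y` becomes constant up to row factors, and subtracting rows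
once more removes it; the remaining columns obey a three-term recurrence that makes them telescope
into sums over `b` (`det_branching`). The weights are the same as for patterns, and the prefactor
depends neither on `a` nor on `β`, so it is also the growth factor of the Weyl denominator.
Induction on `n` gives `patternSum_mul_weylDenom`, over any commutative `ℂ`-algebra in which the
elements `1 + βx_i` are regular: it is used for formal fractional exponents and for complex numbers.

For Koornwinder polynomials, symmetry follows because numerator and denominator change by the same
sign; triangularity and the leading coefficient are read off from patterns. At `q = t = 0` the
density is `D(x) D(x⁻¹) / ∏ (1 + βx_i)(1 + βx_i⁻¹)`, so the denominators cancel in the form and the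
integral splits into circle integrals (`circleIntegral_circleFun_mul`). The polynomials are thus
orthonormal (`koornwinderForm_transLaurent`), and a Gram–Schmidt argument along dominance order
gives uniqueness (`IsKoornwinderFamily.eq_transLaurent`). -/

theorem sum_Icc_sub_pred {M : Type*} [AddCommGroup M] (h : ℤ → M) {p q : ℤ} (hpq : p ≤ q + 1) :
    ∑ c ∈ Finset.Icc p q, (h c - h (c - 1)) = h q - h (p - 1) := by
  obtain ⟨m, rfl⟩ : ∃ m : ℕ, q = p - 1 + m := ⟨(q + 1 - p).toNat, by omega⟩
  clear hpq
  induction m with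
  | zero => simp
  | succ m ih =>
    have : Finset.Icc p (p - 1 + ((m + 1 : ℕ) : ℤ)) =
        insert (p + m) (Finset.Icc p (p - 1 + (m : ℤ))) := by
      ext c; simp only [Finset.mem_insert, Finset.mem_Icc]; push_cast; omega
    rw [this, Finset.sum_insert (by simp), ih]
    have e1 : p - 1 + ((m + 1 : ℕ) : ℤ) = p + m := by push_cast; ring
    have e2 : p + (m : ℤ) - 1 = p - 1 + m := by ring
    rw [e1, e2]; abel

theorem det_sub_succ_rows {R : Type*} [CommRing R] {n : ℕ}
    {V W : Matrix (Fin (n + 1)) (Fin (n + 1)) R} {u : R}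
    (hW : ∀ (i : Fin n) j, W i.castSucc j = V i.castSucc j - V i.succ j)
    (hlast : ∀ j, W (Fin.last n) j = u * V (Fin.last n) j) : W.det = u * V.det := by
  have h1 : W = (W.updateRow (Fin.last n) (u • V (Fin.last n))) := by
    ext i j
    by_cases h : i = Fin.last n
    · subst h; simp [hlast]
    · simp [Matrix.updateRow_apply, h]
  rw [h1, Matrix.det_updateRow_smul]
  congr 1
  -- The row-operation lemma adds the preceding row, whereas here the following row is subtracted;
  -- hence the reversal of the rows.
  rw [← Matrix.det_submatrix_equiv_self Fin.revPerm V,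
    ← Matrix.det_submatrix_equiv_self Fin.revPerm]
  symm
  refine Matrix.det_eq_of_forall_row_eq_smul_add_pred (fun _ => 1) ?_ ?_
  · intro j
    simp
  · intro i j
    have hne : i.rev.castSucc ≠ Fin.last n := (Fin.castSucc_lt_last _).ne
    simp [Matrix.updateRow_apply, Fin.rev_succ, Fin.rev_castSucc, hne, hW]

/-- Taking differences of consecutive rows kills the constant column except for its last entry,
along which the determinant is then expanded. -/
theorem det_of_last_column_one {R : Type*} [CommRing R] {n : ℕ}
    {V : Matrix (Fin (n + 1)) (Fin (n + 1)) R} (hV : ∀ i, V i (Fin.last n) = 1) :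
    V.det = (Matrix.of fun i j : Fin n =>
      V i.castSucc j.castSucc - V i.succ j.castSucc).det := by
  let W : Matrix (Fin (n + 1)) (Fin (n + 1)) R := Matrix.of fun i j =>
    Fin.lastCases (motive := fun _ => R) (V (Fin.last n) j)
      (fun i => V i.castSucc j - V i.succ j) i
  have hdet : W.det = 1 * V.det :=
    det_sub_succ_rows (fun i j => by simp [W]) (fun j => by simp [W])
  rw [one_mul] at hdet
  rw [← hdet, Matrix.det_succ_column W (Fin.last n), Fin.sum_univ_castSucc]
  have h0 : ∀ i : Fin n, W i.castSucc (Fin.last n) = 0 := fun i => by simp [W, hV]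
  have h1 : W (Fin.last n) (Fin.last n) = 1 := by simp [W, hV]
  simp only [h0, h1, mul_zero, zero_mul, Finset.sum_const_zero, zero_add, Fin.succAbove_last,
    Fin.val_last, mul_one, ← two_mul, pow_mul, neg_one_sq, one_pow, one_mul]
  congr 1
  ext i j
  simp [W]

/-! ### Formal powers -/

/-- `x` behaves like `a ↦ x ^ a`. -/
structure IsPow {A : Type*} [CommRing A] (x : ℚ → A) : Prop where
  zero : x 0 = 1
  add : ∀ p q, x (p + q) = x p * x q

theorem IsPow.sum {A : Type*} [CommRing A] {x : ℚ → A} (hx : IsPow x) {ι : Type*}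
    (s : Finset ι) (f : ι → ℚ) : ∏ i ∈ s, x (f i) = x (∑ i ∈ s, f i) := by
  classical
  induction s using Finset.induction_on with
  | empty => simp [hx.zero]
  | insert i s hi ih => rw [Finset.prod_insert hi, Finset.sum_insert hi, hx.add, ih]

/-! ### Interlacing sequences and the branching rule for determinants -/

/-- The integer sequences `c` with `a₁ ≥ c₁ ≥ a₂ ≥ ⋯ ≥ aₙ ≥ cₙ ≥ 0`. -/
def interlaceFull {n : ℕ} (a : Fin (n + 1) → ℤ) : Finset (Fin (n + 1) → ℤ) :=
  Fintype.piFinset fun i =>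
    Finset.Icc (Fin.lastCases (motive := fun _ => ℤ) 0 (fun i => a i.succ) i) (a i)

/-- The integer sequences `b` with `c₁ ≥ b₁ ≥ c₂ ≥ ⋯ ≥ bₙ₋₁ ≥ cₙ`. -/
def interlaceShort {n : ℕ} (c : Fin (n + 1) → ℤ) : Finset (Fin n → ℤ) :=
  Fintype.piFinset fun i => Finset.Icc (c i.succ) (c i.castSucc)

theorem mem_interlaceFull {n : ℕ} {a c : Fin (n + 1) → ℤ} :
    c ∈ interlaceFull a ↔ (∀ i, c i ≤ a i) ∧ (∀ i : Fin n, a i.succ ≤ c i.castSucc) ∧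
      0 ≤ c (Fin.last n) := by
  simp only [interlaceFull, Fintype.mem_piFinset, Finset.mem_Icc]
  constructor
  · intro h
    exact ⟨fun i => (h i).2, fun i => by simpa using (h i.castSucc).1,
      by simpa using (h (Fin.last n)).1⟩
  · rintro ⟨h1, h2, h3⟩ i
    refine ⟨?_, h1 i⟩
    induction i using Fin.lastCases with
    | last => simpa using h3
    | cast i => simpa using h2 i

theorem mem_interlaceShort {n : ℕ} {c : Fin (n + 1) → ℤ} {b : Fin n → ℤ} :
    b ∈ interlaceShort c ↔ ∀ i : Fin n, c i.succ ≤ b i ∧ b i ≤ c i.castSucc := by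
  simp [interlaceShort]

/-- Summation over the interlacing sequences of the shorter kind. -/
theorem sum_interlaceShort_det {A : Type*} [CommRing A] {n : ℕ} {y : ℚ → A} (hy : IsPow y)
    (F : Fin n → ℤ → A) (t : Fin n → A)
    (hrec : ∀ j k, t j * F j k = F j (k + 1) + F j (k - 1))
    {c : Fin (n + 1) → ℤ} (hc : ∀ i : Fin n, c i.succ ≤ c i.castSucc) :
    (Matrix.of fun i j : Fin n =>
        (y (c i.castSucc + n - i + 1) *
            (y 1 * F j (c i.castSucc + n - i) - F j (c i.castSucc + n - i + 1)) -
          y (c i.succ + n - i) *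
            (y 1 * F j (c i.succ + n - i - 1) - F j (c i.succ + n - i)))).det =
      (∏ j, (y 1 * (y 1 + y (-1) - t j))) *
        ∑ b ∈ interlaceShort c, (∏ i : Fin n, y (b i + n - i)) *
          (Matrix.of fun i j : Fin n => F j (b i + n - i)).det := by
  -- By the three-term recurrence, `M j` is a discrete primitive of `y^k F_k`, up to the factor `y
  -- (y + y⁻¹ - t_j)` that does not depend on `k`.
  let M : Fin n → ℤ → A := fun j k => y (k + 1) * (y 1 * F j k - F j (k + 1))
  have hM : ∀ j k, M j k - M j (k - 1) = (y 1 * (y 1 + y (-1) - t j)) * (y k * F j k) := by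
    intro j k
    have h1 : y (k + 1) = y k * y 1 := hy.add _ _
    have h2 : y (((k - 1 : ℤ) : ℚ) + 1) = y k := by congr 1; push_cast; ring
    have h3 : y 1 * y (-1) = 1 := by rw [← hy.add, add_neg_cancel, hy.zero]
    simp only [M, h1, h2, sub_add_cancel]
    linear_combination (y k * y 1) * hrec j k - y k * F j k * h3
  let g : Fin n → ℤ → Fin n → A := fun i b j =>
    (y 1 * (y 1 + y (-1) - t j)) * (y (b + n - i) * F j (b + n - i))
  have hrow : (Matrix.of fun i j : Fin n =>
        (y (c i.castSucc + n - i + 1) *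
            (y 1 * F j (c i.castSucc + n - i) - F j (c i.castSucc + n - i + 1)) -
          y (c i.succ + n - i) *
            (y 1 * F j (c i.succ + n - i - 1) - F j (c i.succ + n - i)))) =
      fun i => ∑ b ∈ Finset.Icc (c i.succ) (c i.castSucc), g i b := by
    funext i j
    have := sum_Icc_sub_pred (fun b : ℤ => M j (b + n - i))
      (p := c i.succ) (q := c i.castSucc) (by linarith [hc i])
    rw [Finset.sum_apply]
    have e : ∀ b ∈ Finset.Icc (c i.succ) (c i.castSucc),
        g i b j = M j (b + n - i) - M j (b - 1 + n - i) := by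
      intro b _
      have := hM j (b + n - i)
      rw [show b + n - i - 1 = b - 1 + n - (i : ℤ) by ring] at this
      rw [this]
      simp [g]
    rw [Finset.sum_congr rfl e, this]
    simp only [M, Matrix.of_apply]
    rw [show c i.succ - 1 + n - (i : ℤ) = c i.succ + n - i - 1 by ring]
    push_cast
    simp only [sub_add_cancel]
  rw [hrow]
  -- Each row is now a sum over one `b i`; multilinearity in the rows turns the determinant into a
  -- sum over all interlacing `b`.
  have := (Matrix.detRowAlternating (n := Fin n) (R := A)).toMultilinearMap.map_sum_finset g
    (fun i => Finset.Icc (c i.succ) (c i.castSucc))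
  refine this.trans ?_
  rw [Finset.mul_sum]
  refine Finset.sum_congr rfl fun b _ => ?_
  change Matrix.det (Matrix.of fun i j => (y 1 * (y 1 + y (-1) - t j)) *
    ((Matrix.of fun i j => y (b i + n - i) * F j (b i + n - i)) i j)) = _
  rw [Matrix.det_mul_row]
  congr 1
  exact Matrix.det_mul_column (fun i : Fin n => y (b i + n - i))
    (Matrix.of fun i j : Fin n => F j (b i + n - i))

/-- Summing `v k - v (k - 1)` over `c i` between `a (i+1)` and `a i` gives the difference of two
consecutive rows. The last row has no successor: its sum starts at `c = 0` and would leave `v (-1)`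
behind, and the special weight `w₀` at `c = 0` is what replaces that boundary term and makes the row
`u` times the original one. -/
theorem sum_rows_interlaceFull_det {A : Type*} [CommRing A] {n : ℕ} (v : ℤ → Fin (n + 1) → A)
    {u w₀ : A} (hinit : ∀ j, w₀ * (v 0 j - v (-1) j) = u * v 0 j)
    {a : Fin (n + 1) → ℤ} (ha : Antitone a) (ha0 : 0 ≤ a (Fin.last n)) :
    u * (Matrix.of fun i j => v (a i + n - i) j).det =
      ∑ c ∈ interlaceFull a, (if c (Fin.last n) = 0 then w₀ else u) *
        (Matrix.of fun i j => v (c i + n - i) j - v (c i + n - i - 1) j).det := by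
  let e : Fin (n + 1) → ℤ → A := fun i c =>
    if i = Fin.last n then (if c = 0 then w₀ else u) else 1
  let g : Fin (n + 1) → ℤ → Fin (n + 1) → A := fun i c j =>
    e i c * (v (c + n - i) j - v (c + n - i - 1) j)
  let I : Fin (n + 1) → Finset ℤ := fun i =>
    Finset.Icc (Fin.lastCases (motive := fun _ => ℤ) 0 (fun i => a i.succ) i) (a i)
  have h1 := det_sub_succ_rows (V := Matrix.of fun i j => v (a i + n - i) j)
    (W := Matrix.of fun i j => ∑ c ∈ I i, g i c j) (u := u) ?_ ?_
  · rw [← h1]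
    have h2 : (Matrix.of fun i j => ∑ c ∈ I i, g i c j) = fun i => ∑ c ∈ I i, g i c := by
      funext i j; simp [Finset.sum_apply]
    rw [h2]
    refine ((Matrix.detRowAlternating (n := Fin (n + 1)) (R := A)).toMultilinearMap.map_sum_finset
      g I).trans ?_
    refine Finset.sum_congr rfl fun c _ => ?_
    refine (Matrix.det_mul_column (fun i => e i (c i))
      (Matrix.of fun i j => v (c i + n - i) j - v (c i + n - i - 1) j)).trans ?_
    congr 1
    rw [Fin.prod_univ_castSucc, Finset.prod_eq_one]
    · simp [e]
    · intro i _
      simp [e, (Fin.castSucc_lt_last i).ne]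
  · intro i j
    have hle : a i.succ ≤ a i.castSucc := ha (Fin.castSucc_lt_succ).le
    have := sum_Icc_sub_pred (fun c : ℤ => v (c + n - i) j) (p := a i.succ) (q := a i.castSucc)
      (by linarith)
    simp only [Matrix.of_apply, I, g, e, Fin.lastCases_castSucc, (Fin.castSucc_lt_last i).ne,
      if_false, one_mul, Fin.val_castSucc, Fin.val_succ]
    refine Eq.trans (Finset.sum_congr rfl fun c _ => ?_) (this.trans ?_)
    · rw [show c + n - (i : ℤ) - 1 = c - 1 + n - i by ring]
    · rw [show a i.succ + n - ((i + 1 : ℕ) : ℤ) = a i.succ - 1 + n - i by push_cast; ring]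
  · intro j
    simp only [Matrix.of_apply, I, g, e, Fin.lastCases_last, if_true, Fin.val_last,
      add_sub_cancel_right]
    have hI : Finset.Icc 0 (a (Fin.last n)) = insert 0 (Finset.Icc 1 (a (Fin.last n))) := by
      ext c; simp only [Finset.mem_insert, Finset.mem_Icc]; omega
    rw [hI, Finset.sum_insert (by simp), if_pos rfl, zero_sub, hinit]
    -- For `a (Fin.last n) = 0` the interval is empty, the extreme case `p = q + 1` of the
    -- telescoping lemma.
    have := sum_Icc_sub_pred (fun c : ℤ => v c j) (p := 1) (q := a (Fin.last n)) (by linarith)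
    rw [sub_self] at this
    have h3 : ∀ c ∈ Finset.Icc 1 (a (Fin.last n)),
        (if c = 0 then w₀ else u) * (v c j - v (c - 1) j) = u * (v c j - v (c - 1) j) := by
      intro c hc
      rw [if_neg]
      have := (Finset.mem_Icc.1 hc).1
      omega
    rw [Finset.sum_congr rfl h3, ← Finset.mul_sum, this]
    ring

/-- The branching rule for determinants. -/
theorem det_branching {A : Type*} [CommRing A] {n : ℕ} {y : ℚ → A} (hy : IsPow y)
    (Φ : Fin (n + 1) → ℤ → A) (t : Fin n → A) {u η w₀ : A} (hu : ∀ r s, u * r = u * s → r = s)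
    (hrec : ∀ j k, t j * Φ (Fin.castSucc j) k =
      Φ (Fin.castSucc j) (k + 1) + Φ (Fin.castSucc j) (k - 1))
    (hlast : ∀ k : ℤ, y (1 - k) * Φ (Fin.last n) (k + 1) - y (2 - k) * Φ (Fin.last n) k =
      u * η * (y 2 - 1) * y (-2 * k))
    (hinit : ∀ j, w₀ * (y 1 * Φ j 1 - y 2 * Φ j 0) = u * (y 1 * Φ j 1))
    {a : Fin (n + 1) → ℤ} (ha : Antitone a) (ha0 : 0 ≤ a (Fin.last n)) :
    (Matrix.of fun i j => Φ j (a i + n - i + 1)).det =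
      ((y 1 - y (-1)) * ∏ j, (t j - y 1 - y (-1))) *
        ∑ c ∈ interlaceFull a, ∑ b ∈ interlaceShort c,
          (if c (Fin.last n) = 0 then w₀ else u) * η *
            y ((∑ i, a i : ℤ) - 2 * (∑ i, c i : ℤ) + (∑ i, b i : ℤ)) *
            (Matrix.of fun i j : Fin n => Φ j.castSucc (b i + n - i)).det := by
  have hinv : ∀ q, y q * y (-q) = 1 := fun q => by rw [← hy.add, add_neg_cancel, hy.zero]
  -- The rescaling by `y^(1-k)` is chosen so that, by `hlast`, the differences in the last column
  -- are a constant times `y^(-2k)`.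
  let v : ℤ → Fin (n + 1) → A := fun k j => y (1 - k) * Φ j (k + 1)
  have h1 := sum_rows_interlaceFull_det v (u := u) (w₀ := w₀) (fun j => by
    have := hinit j
    simp only [v]
    norm_num at this ⊢
    exact this) ha ha0
  have h2 : (Matrix.of fun i j => v (a i + n - i) j).det =
      (∏ i : Fin (n + 1), y (1 - (a i + n - i))) *
        (Matrix.of fun i j => Φ j (a i + n - i + 1)).det := by
    rw [← Matrix.det_mul_column]
    congr 1
    ext i j
    simp [v]
  have h3 : ∀ c ∈ interlaceFull a,
      (Matrix.of fun i j => v (c i + n - i) j - v (c i + n - i - 1) j).det =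
        u * ((∏ i : Fin (n + 1), y (-2 * (c i + n - i))) * ((-1) ^ n * (η * (y 2 - 1))) *
          ((∏ j, (y 1 * (y 1 + y (-1) - t j))) *
        ∑ b ∈ interlaceShort c, (∏ i : Fin n, y (b i + n - i)) *
          (Matrix.of fun i j : Fin n => Φ j.castSucc (b i + n - i)).det)) := by
    intro c hc
    rw [mem_interlaceFull] at hc
    -- `V` is what remains after extracting `y^(-2k)` from each row and the constants `C` from the
    -- columns: its last column is `1` and the others are the primitives of
    -- `sum_interlaceShort_det`.
    let V : Matrix (Fin (n + 1)) (Fin (n + 1)) A := Matrix.of fun i j =>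
      Fin.lastCases (motive := fun _ => A) 1 (fun j =>
        y (c i + n - i + 1) * (y 1 * Φ j.castSucc (c i + n - i) -
          Φ j.castSucc (c i + n - i + 1))) j
    let C : Fin (n + 1) → A :=
      Fin.lastCases (motive := fun _ => A) (u * (η * (y 2 - 1))) (fun _ => -1)
    have e1 : (Matrix.of fun i j => v (c i + n - i) j - v (c i + n - i - 1) j) =
        Matrix.of fun i j => C j * (Matrix.of fun i j => y (-2 * (c i + n - i)) * V i j) i j := by
      ext i j
      generalize hk : (c i + n - i : ℤ) = k
      have hk' : (c i + n - i : ℚ) = k := by rw [← hk]; push_cast; ring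
      have e2 : y (1 - ((k - 1 : ℤ) : ℚ)) = y (2 - k) := by congr 1; push_cast; ring
      simp only [Matrix.of_apply, v, hk, hk', V, C, e2, sub_add_cancel]
      induction j using Fin.lastCases with
      | last =>
        rw [hlast]
        simp
        ring
      | cast j =>
        have e3 : y (1 - (k : ℚ)) = y (-2 * k) * y (k + 1) := by rw [← hy.add]; congr 1; ring
        have e4 : y (2 - (k : ℚ)) = y (-2 * k) * y (k + 1) * y 1 := by
          rw [← hy.add, ← hy.add]; congr 1; ring
        simp only [Fin.lastCases_castSucc, e3, e4]
        ring
    rw [e1, Matrix.det_mul_row, Matrix.det_mul_column, Fin.prod_univ_castSucc C]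
    have e5 : V.det = _ := det_of_last_column_one (V := V) (fun i => by simp [V])
    have e6 := sum_interlaceShort_det hy (fun j : Fin n => Φ j.castSucc) t hrec (c := c)
      (fun i => (hc.1 i.succ).trans (hc.2.1 i))
    rw [e5]
    have e7 : (Matrix.of fun i j : Fin n =>
        V i.castSucc j.castSucc - V i.succ j.castSucc) = (Matrix.of fun i j : Fin n =>
        (y (c i.castSucc + n - i + 1) *
            (y 1 * Φ j.castSucc (c i.castSucc + n - i) -
              Φ j.castSucc (c i.castSucc + n - i + 1)) -
          y (c i.succ + n - i) *
            (y 1 * Φ j.castSucc (c i.succ + n - i - 1) - Φ j.castSucc (c i.succ + n - i)))) := by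
      ext i j
      have f1 : (c i.succ + n - ((i + 1 : ℕ) : ℚ) + 1) = c i.succ + n - i := by push_cast; ring
      have f2 : (c i.succ + n - ((i + 1 : ℕ) : ℤ)) = c i.succ + n - i - 1 := by push_cast; ring
      simp only [V, Matrix.of_apply, Fin.lastCases_castSucc, Fin.val_castSucc, Fin.val_succ, f1,
        f2, sub_add_cancel]
    rw [e7, e6]
    simp only [C, Fin.lastCases_castSucc, Fin.lastCases_last, Finset.prod_const, Finset.card_univ,
      Fintype.card_fin]
    ring
  rw [h2, Finset.sum_congr rfl (fun c hc => by rw [h3 c hc])] at h1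
  -- The extra factor `u` on the right comes from the constant in the last column; regularity of `u`
  -- cancels it against the one introduced by the weighted telescoping.
  have h4 := hu _ (∑ c ∈ interlaceFull a, (if c (Fin.last n) = 0 then w₀ else u) *
        ((∏ i : Fin (n + 1), y (-2 * (c i + n - i))) * ((-1) ^ n * (η * (y 2 - 1))) *
          ((∏ j, (y 1 * (y 1 + y (-1) - t j))) *
        ∑ b ∈ interlaceShort c, (∏ i : Fin n, y (b i + n - i)) *
          (Matrix.of fun i j : Fin n => Φ j.castSucc (b i + n - i)).det)))
    (h1.trans (by rw [Finset.mul_sum]; exact Finset.sum_congr rfl fun c _ => by ring))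
  have h5 : (∏ i : Fin (n + 1), y (-(1 - (a i + n - i)))) *
      (∏ i : Fin (n + 1), y (1 - (a i + n - i))) = 1 := by
    rw [← Finset.prod_mul_distrib]
    exact Finset.prod_eq_one fun i _ => by rw [mul_comm, hinv]
  have h6 := congrArg ((∏ i : Fin (n + 1), y (-(1 - (a i + n - i)))) * ·) h4
  rw [← mul_assoc, h5, one_mul] at h6
  rw [h6, Finset.mul_sum, Finset.mul_sum]
  refine Finset.sum_congr rfl fun c _ => ?_
  simp only [Finset.mul_sum]
  refine Finset.sum_congr rfl fun b _ => ?_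
  have h7 : (∏ j, (y 1 * (y 1 + y (-1) - t j))) = y n * ((-1) ^ n * ∏ j, (t j - y 1 - y (-1))) := by
    have : ∀ j, y 1 * (y 1 + y (-1) - t j) = y 1 * (-1 * (t j - y 1 - y (-1))) := fun j => by ring
    simp only [this, Finset.prod_mul_distrib]
    rw [hy.sum]
    simp
  have h8 : y 2 - 1 = y 1 * (y 1 - y (-1)) := by
    rw [mul_sub, hinv, ← hy.add]; norm_num
  -- The staircase contributions `n - i` of `a`, `b` and `c` cancel, and the constants `-(n + 1)`,
  -- `n` and `1` add up to zero.
  have h9 : (∏ i : Fin (n + 1), y (-(1 - (a i + n - i)))) *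
      ((∏ i : Fin (n + 1), y (-2 * (c i + n - i))) * (y n * (y 1 *
        (∏ i : Fin n, y (b i + n - i))))) =
      y ((∑ i, a i : ℤ) - 2 * (∑ i, c i : ℤ) + (∑ i, b i : ℤ)) := by
    rw [hy.sum, hy.sum, hy.sum]
    simp only [← hy.add]
    congr 1
    have g1 : ∑ i : Fin (n + 1), ((n : ℚ) - i) = ∑ i : Fin n, ((n : ℚ) - i) := by
      rw [Fin.sum_univ_castSucc]; simp
    have g2 : ∑ i : Fin (n + 1), (-(1 - ((a i : ℚ) + n - i))) =
        -(n + 1) + ∑ i, (a i : ℚ) + ∑ i : Fin (n + 1), ((n : ℚ) - i) := by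
      have : ∀ i : Fin (n + 1), (-(1 - ((a i : ℚ) + n - i))) = -1 + (a i + (n - i)) :=
        fun i => by ring
      simp only [this]
      rw [Finset.sum_add_distrib, Finset.sum_add_distrib]
      simp only [Finset.sum_const, Finset.card_univ, Fintype.card_fin, nsmul_eq_mul]
      push_cast
      ring
    have g3 : ∑ i : Fin (n + 1), (-2 * ((c i : ℚ) + n - i)) =
        -2 * (∑ i, (c i : ℚ) + ∑ i : Fin (n + 1), ((n : ℚ) - i)) := by
      rw [← Finset.sum_add_distrib, Finset.mul_sum]
      exact Finset.sum_congr rfl fun i _ => by ring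
    have g4 : ∑ i : Fin n, ((b i : ℚ) + n - i) =
        (∑ i, (b i : ℚ) + ∑ i : Fin n, ((n : ℚ) - i)) := by
      rw [← Finset.sum_add_distrib]
      exact Finset.sum_congr rfl fun i _ => by ring
    rw [g2, g3, g4, g1]
    push_cast
    ring
  have h10 : ((-1 : A) ^ n) * (-1) ^ n = 1 := by rw [← mul_pow]; simp
  rw [h7, h8, ← h9]
  linear_combination ((∏ i : Fin (n + 1), y (-(1 - (a i + n - i)))) *
    (if c (Fin.last n) = 0 then w₀ else u) * (∏ i : Fin (n + 1), y (-2 * (c i + n - i))) *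
    η * y 1 * (y 1 - y (-1)) * y n * (∏ j, (t j - y 1 - y (-1))) *
    (∏ i : Fin n, y (b i + n - i)) *
    (Matrix.of fun i j : Fin n => Φ j.castSucc (b i + n - i)).det) * h10

/-! ### Pattern sums over arbitrary algebras and their branching rule -/

/-- The exponent of `xᵢ` in the monomial of a pattern; `i` is numbered from `0`. -/
def patternExponent (z : ℕ → ℕ → ℚ) (i : ℕ) : ℚ :=
  patternType z (2 * (i + 1)) - patternType z (2 * (i + 1) - 1)

/-- The interpolating polynomial with arbitrary powers substituted for the variables. -/
def patternSum {A : Type*} [CommRing A] [Algebra ℂ A] {n : ℕ} (lam : Fin n → ℚ) (β : ℂ)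
    (x : Fin n → ℚ → A) : A :=
  ∑ z ∈ (splitPatterns_finite lam).toFinset,
    β ^ atypCount n z • ∏ i : Fin n, x i (patternExponent z i)

theorem transCB_eq_patternSum {n : ℕ} (lam : Fin n → ℚ) (β : ℂ) :
    transCB lam β = patternSum lam β xpow := rfl

/-- The vector `a + d / 2`. -/
def halfShift {n : ℕ} (d : ℕ) (a : Fin n → ℤ) : Fin n → ℚ := fun i => a i + d / 2

/-- A finite vector as a one-based row of an array. -/
def rowOf {m : ℕ} (v : Fin m → ℚ) (j : ℕ) : ℚ :=
  if h : 1 ≤ j ∧ j ≤ m then v ⟨j - 1, by omega⟩ else 0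

@[simp] theorem rowOf_succ {m : ℕ} (v : Fin m → ℚ) (j : Fin m) : rowOf v ((j : ℕ) + 1) = v j := by
  have : 1 ≤ (j : ℕ) + 1 ∧ (j : ℕ) + 1 ≤ m := by omega
  simp [rowOf, this]

theorem rowOf_outside {m : ℕ} (v : Fin m → ℚ) {j : ℕ} (h : ¬(1 ≤ j ∧ j ≤ m)) : rowOf v j = 0 := by
  simp only [rowOf, h, dif_neg, not_false_eq_true]

/-- The array of height `2n + 2` obtained by adding two rows to an array of height `2n`. -/
def extendPattern (n : ℕ) (z : ℕ → ℕ → ℚ) (κ lam : Fin (n + 1) → ℚ) : ℕ → ℕ → ℚ := fun i j =>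
  if i ≤ 2 * n then z i j
  else if i = 2 * n + 1 then rowOf κ j
  else if i = 2 * n + 2 then rowOf lam j else 0

section extend
variable {n : ℕ} (z : ℕ → ℕ → ℚ) (κ lam : Fin (n + 1) → ℚ)

theorem extendPattern_of_le {i : ℕ} (h : i ≤ 2 * n) (j : ℕ) :
    extendPattern n z κ lam i j = z i j := by simp [extendPattern, h]

theorem extendPattern_odd (j : ℕ) : extendPattern n z κ lam (2 * n + 1) j = rowOf κ j := by
  simp [extendPattern]

theorem extendPattern_even (j : ℕ) : extendPattern n z κ lam (2 * n + 2) j = rowOf lam j := by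
  simp [extendPattern]

end extend

/-- The row of index `2n + 1`, with an atypical last entry if `s = 1`. -/
def oddRow {n : ℕ} (d : ℕ) (c : Fin (n + 1) → ℤ) (s : ℕ) : Fin (n + 1) → ℚ := fun j =>
  c j + d / 2 - if j = Fin.last n then (s : ℚ) / 2 else 0

theorem toNat_cast_rat {m : ℤ} (hm : 0 ≤ m) : ((m.toNat : ℕ) : ℚ) = m := by
  exact_mod_cast Int.toNat_of_nonneg hm

theorem int_ne_int_add_half (m k : ℤ) : (m : ℚ) ≠ k + 1 / 2 := by
  intro h
  have : (2 * m : ℚ) = 2 * k + 1 := by linarith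
  have : 2 * m = 2 * k + 1 := by exact_mod_cast this
  omega

theorem IsSplitOrthogonalPattern.same_kind' {n d : ℕ} (hd : d ≤ 1) {z : ℕ → ℕ → ℚ}
    (hz : IsSplitOrthogonalPattern n z) {k : ℤ} (hk : z (2 * n) 1 = k + d / 2) {i j : ℕ}
    (hij : InHalfTriangle n i j) (ho : i + 1 ≠ 2 * j) : ∃ m : ℕ, z i j = m + d / 2 := by
  have hn : InHalfTriangle n (2 * n) 1 := by
    obtain ⟨h1, h2, h3, h4⟩ := hij
    exact ⟨by omega, le_rfl, le_rfl, by omega⟩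
  have hne : 2 * n + 1 ≠ 2 * 1 := by omega
  rcases hz.same_kind with h | h
  · obtain ⟨m, hm⟩ := h i j hij ho
    obtain ⟨m', hm'⟩ := h _ _ hn hne
    interval_cases d
    · exact ⟨m, by simp [hm]⟩
    · exfalso
      rw [hm'] at hk
      exact int_ne_int_add_half m' k (by push_cast at hk ⊢; linarith)
  · obtain ⟨m, hm⟩ := h i j hij ho
    obtain ⟨m', hm'⟩ := h _ _ hn hne
    interval_cases d
    · exfalso
      rw [hm'] at hk
      exact int_ne_int_add_half k m' (by push_cast at hk ⊢; linarith)
    · exact ⟨m, by rw [hm]; push_cast; ring⟩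

theorem isAtypical_iff {n d : ℕ} (hd : d ≤ 1) {z : ℕ → ℕ → ℚ} {k : ℤ}
    (hk : z (2 * n) 1 = k + d / 2) (i j : ℕ) :
    IsAtypical n z i j ↔ ∃ m : ℤ, z i j = m + d / 2 - 1 / 2 := by
  unfold IsAtypical
  rw [hk]
  interval_cases d
  · constructor
    · rintro (⟨-, m, hm⟩ | ⟨⟨m, hm⟩, -⟩)
      · exact ⟨m + 1, by rw [hm]; push_cast; ring⟩
      · exact absurd (by push_cast at hm ⊢; linarith) (int_ne_int_add_half k m)
    · rintro ⟨m, hm⟩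
      exact Or.inl ⟨⟨k, by simp⟩, m - 1, by rw [hm]; push_cast; ring⟩
  · constructor
    · rintro (⟨⟨m, hm⟩, -⟩ | ⟨-, m, hm⟩)
      · exact absurd (by push_cast at hm ⊢; linarith) (int_ne_int_add_half m k)
      · exact ⟨m, by rw [hm]; push_cast; ring⟩
    · rintro ⟨m, hm⟩
      exact Or.inr ⟨⟨k, by simp⟩, m, by rw [hm]; push_cast; ring⟩

/-- The odd end has no neighbour bounding it from below, so lowering it by `1/2` can violate only
nonnegativity. This is what `hsc` controls: it forbids an atypical end exactly when `c` ends in `0`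
and `d = 0`. -/
theorem extendPattern_mem {n d : ℕ} (hd : d ≤ 1) {a c : Fin (n + 1) → ℤ} {b : Fin n → ℤ} {s : ℕ}
    (hs : s ≤ 1) {z : ℕ → ℕ → ℚ} (hc : c ∈ interlaceFull a) (hb : b ∈ interlaceShort c)
    (hsc : (s : ℤ) ≤ 2 * c (Fin.last n) + d) (hz : z ∈ splitPatterns (halfShift d b)) :
    extendPattern n z (oddRow d c s) (halfShift d a) ∈ splitPatterns (halfShift d a) := by
  obtain ⟨hc1, hc2, hc3⟩ := mem_interlaceFull.1 hc
  have hb' := mem_interlaceShort.1 hb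
  have hca : Antitone c := Fin.antitone_iff_succ_le.2 fun i => (hb' i).1.trans (hb' i).2
  have hs2 : (s : ℚ) / 2 ≤ 1 / 2 := by
    have : (s : ℚ) ≤ 1 := by exact_mod_cast hs
    linarith
  have hs0 : (0 : ℚ) ≤ s / 2 := by positivity
  have hle : ∀ i, oddRow d c s i ≤ c i + d / 2 := fun i => by
    unfold oddRow; split_ifs <;> linarith
  have hcast : ∀ i : Fin n, oddRow d c s i.castSucc = c i.castSucc + d / 2 := fun i => by
    simp [oddRow, (Fin.castSucc_lt_last i).ne]
  have hc0 : ∀ i, 0 ≤ c i := fun i => hc3.trans (hca (Fin.le_last i))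
  have ha0 : ∀ i, 0 ≤ a i := fun i => (hc0 i).trans (hc1 i)
  obtain ⟨hzp, hzs⟩ := hz
  have hkind : ∀ i j, InHalfTriangle n i j → i + 1 ≠ 2 * j → ∃ m : ℕ, z i j = m + d / 2 := by
    intro i j hij ho
    have hn : 0 < n := by obtain ⟨h1, h2, h3, h4⟩ := hij; omega
    exact hzp.same_kind' hd (k := b ⟨0, hn⟩) (by simpa [halfShift] using hzs ⟨0, hn⟩) hij ho
  have hkind' : ∀ i j, InHalfTriangle (n + 1) i j → i + 1 ≠ 2 * j →
      ∃ m : ℕ, extendPattern n z (oddRow d c s) (halfShift d a) i j = m + d / 2 := by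
    rintro i j ⟨h1, h2, h3, h4⟩ ho
    rcases (by omega : i ≤ 2 * n ∨ i = 2 * n + 1 ∨ i = 2 * n + 2) with h | rfl | rfl
    · rw [extendPattern_of_le _ _ _ h]
      exact hkind i j ⟨h1, h, h3, h4⟩ ho
    · rw [extendPattern_odd]
      obtain ⟨k, rfl⟩ : ∃ k : Fin n, j = k + 1 := ⟨⟨j - 1, by omega⟩, by simp; omega⟩
      rw [← Fin.val_castSucc k, rowOf_succ, hcast]
      refine ⟨(c k.castSucc).toNat, ?_⟩
      rw [toNat_cast_rat (hc0 _)]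
    · rw [extendPattern_even]
      obtain ⟨k, rfl⟩ : ∃ k : Fin (n + 1), j = k + 1 := ⟨⟨j - 1, by omega⟩, by simp; omega⟩
      rw [rowOf_succ]
      refine ⟨(a k).toNat, ?_⟩
      rw [toNat_cast_rat (ha0 _), halfShift]
  refine ⟨⟨?_, ?_, ?_, ?_, ?_⟩, fun j => ?_⟩
  · intro i j hij
    unfold extendPattern
    unfold InHalfTriangle at hij
    split_ifs with h1 h2 h3
    · exact hzp.eq_zero_outside i j (by unfold InHalfTriangle; omega)
    · exact rowOf_outside _ (by omega)
    · exact rowOf_outside _ (by omega)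
    · rfl
  · rintro i j ⟨h1, h2, h3, h4⟩ ho
    rcases (by omega : i ≤ 2 * n ∨ i = 2 * n + 1) with h | rfl
    · rw [extendPattern_of_le _ _ _ h]
      exact hzp.odd_end i j ⟨h1, h, h3, h4⟩ ho
    · rw [extendPattern_odd]
      obtain rfl : j = (Fin.last n : ℕ) + 1 := by simp; omega
      rw [rowOf_succ]
      refine ⟨(2 * c (Fin.last n) + d - s).toNat, ?_⟩
      rw [toNat_cast_rat (by omega), oddRow, if_pos rfl]
      push_cast
      ring
  · interval_cases d
    · exact Or.inl fun i j hij ho => by simpa using hkind' i j hij ho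
    · exact Or.inr fun i j hij ho => by
        obtain ⟨m, hm⟩ := hkind' i j hij ho
        exact ⟨m, by rw [hm]; push_cast; ring⟩
  · rintro i j ⟨h1, h2, h3, h4⟩ ⟨h1', h2', h3', h4'⟩
    rcases (by omega : i + 1 ≤ 2 * n ∨ i = 2 * n ∨ i = 2 * n + 1) with h | rfl | rfl
    · rw [extendPattern_of_le _ _ _ h, extendPattern_of_le _ _ _ (by omega)]
      exact hzp.interlace_left i j ⟨h1, by omega, h3, h4⟩ ⟨h1', h, h3', h4'⟩
    · rw [extendPattern_odd, extendPattern_of_le _ _ _ le_rfl]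
      obtain ⟨k, rfl⟩ : ∃ k : Fin n, j = k + 1 := ⟨⟨j - 1, by omega⟩, by simp; omega⟩
      rw [← Fin.val_succ k, rowOf_succ, Fin.val_succ, hzs]
      refine (hle _).trans ?_
      have : (c k.succ : ℚ) ≤ b k := by exact_mod_cast (hb' k).1
      simp only [halfShift]; linarith
    · rw [extendPattern_odd, extendPattern_even]
      obtain ⟨k, rfl⟩ : ∃ k : Fin n, j = k + 1 := ⟨⟨j - 1, by omega⟩, by simp; omega⟩
      rw [← Fin.val_succ k, rowOf_succ, Fin.val_succ, ← Fin.val_castSucc k, rowOf_succ, hcast]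
      have : (a k.succ : ℚ) ≤ c k.castSucc := by exact_mod_cast hc2 k
      simp only [halfShift]; linarith
  · rintro i j ⟨h1, h2, h3, h4⟩ ⟨h1', h2', h3', h4'⟩
    rcases (by omega : i + 1 ≤ 2 * n ∨ i = 2 * n ∨ i = 2 * n + 1) with h | rfl | rfl
    · rw [extendPattern_of_le _ _ _ h, extendPattern_of_le _ _ _ (by omega)]
      exact hzp.interlace_right i j ⟨h1, by omega, h3, h4⟩ ⟨h1', h, h3', h4'⟩
    · rw [extendPattern_odd, extendPattern_of_le _ _ _ le_rfl]
      obtain ⟨k, rfl⟩ : ∃ k : Fin n, j = k + 1 := ⟨⟨j - 1, by omega⟩, by simp; omega⟩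
      rw [hzs, ← Fin.val_castSucc k, rowOf_succ, hcast]
      have : (b k : ℚ) ≤ c k.castSucc := by exact_mod_cast (hb' k).2
      simp only [halfShift]; linarith
    · rw [extendPattern_odd, extendPattern_even]
      obtain ⟨k, rfl⟩ : ∃ k : Fin (n + 1), j = k + 1 := ⟨⟨j - 1, by omega⟩, by simp; omega⟩
      rw [rowOf_succ, rowOf_succ]
      refine (hle _).trans ?_
      have : (c k : ℚ) ≤ a k := by exact_mod_cast hc1 k
      simp only [halfShift]; linarith
  · rw [show 2 * (n + 1) = 2 * n + 2 by ring, extendPattern_even, rowOf_succ]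

/-- The vector `c` comes from rounding the odd end up to the class of `d`. Its upper bounds lie in
that class already, so the interlacing inequalities survive the rounding. -/
theorem exists_extendPattern {n d : ℕ} (hd : d ≤ 1) {a : Fin (n + 1) → ℤ} {z : ℕ → ℕ → ℚ}
    (hz : z ∈ splitPatterns (halfShift d a)) :
    ∃ c ∈ interlaceFull a, ∃ b ∈ interlaceShort c, ∃ s : ℕ, s ≤ 1 ∧ (s : ℤ) ≤ 2 * c (Fin.last n) + d ∧
      ∃ z' ∈ splitPatterns (halfShift d b),
        z = extendPattern n z' (oddRow d c s) (halfShift d a) := by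
  obtain ⟨hzp, hzs⟩ := hz
  have hkind := fun i j => hzp.same_kind' hd (k := a 0) (by simpa [halfShift] using hzs 0) (i := i) (j := j)
  have hzs' : ∀ j : Fin (n + 1), z (2 * n + 2) (j + 1) = a j + d / 2 := hzs
  have hodd : ∀ j : Fin n, ∃ m : ℕ, z (2 * n + 1) (j + 1) = m + d / 2 := fun j =>
    hkind _ _ ⟨by omega, by omega, by omega, by omega⟩ (by omega)
  have heven : ∀ j : Fin n, ∃ m : ℕ, z (2 * n) (j + 1) = m + d / 2 := fun j =>
    hkind _ _ ⟨by have := j.isLt; omega, by omega, by omega, by omega⟩ (by omega)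
  choose c' hc' using hodd
  choose b hb using heven
  obtain ⟨m, hm⟩ := hzp.odd_end (2 * n + 1) (n + 1) ⟨by omega, by omega, by omega, by omega⟩
    (by omega)
  -- Here `m` is twice the odd end, and the parity of `m + d` decides whether it is atypical.
  obtain ⟨s, hs, c₀, hcs⟩ : ∃ s : ℕ, s ≤ 1 ∧ ∃ c₀ : ℤ, (m : ℤ) = 2 * c₀ + d - s := by
    rcases Nat.even_or_odd' (m + d) with ⟨k, hk | hk⟩
    · exact ⟨0, by omega, k - d, by push_cast; omega⟩
    · exact ⟨1, le_rfl, k + 1 - d, by push_cast; omega⟩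
  have hlast : z (2 * n + 1) (n + 1) = c₀ + d / 2 - s / 2 := by
    have : (m : ℚ) = 2 * c₀ + d - s := by exact_mod_cast hcs
    rw [hm, this]; ring
  let c : Fin (n + 1) → ℤ := Fin.lastCases (motive := fun _ => ℤ) c₀ (fun j => (c' j : ℤ))
  have hcl : c (Fin.last n) = c₀ := by simp [c]
  have hcc : ∀ j, c (Fin.castSucc j) = c' j := fun j => by simp [c]
  have hrow : ∀ j : Fin (n + 1), z (2 * n + 1) (j + 1) = oddRow d c s j := by
    intro j
    induction j using Fin.lastCases with
    | last => simp [oddRow, hcl, hlast]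
    | cast j => simp [oddRow, hcc, hc', (Fin.castSucc_lt_last j).ne]
  have hs2 : (s : ℚ) / 2 ≤ 1 / 2 := by
    have : (s : ℚ) ≤ 1 := by exact_mod_cast hs
    linarith
  have hge : ∀ j, (c j : ℚ) + d / 2 - 1 / 2 ≤ oddRow d c s j := fun j => by
    unfold oddRow; split_ifs <;> linarith
  have hcomp : ∀ (j : Fin (n + 1)) (m : ℤ), oddRow d c s j ≤ m + d / 2 → c j ≤ m := by
    intro j m h
    have h1 := hge j
    have : (2 * c j : ℚ) ≤ 2 * m + 1 := by linarith
    have : 2 * c j ≤ 2 * m + 1 := by exact_mod_cast this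
    omega
  refine ⟨c, ?_, fun j => b j, ?_, s, hs, by rw [hcl]; omega,
    fun i j => if i ≤ 2 * n then z i j else 0, ⟨⟨?_, ?_, ?_, ?_, ?_⟩, ?_⟩, ?_⟩
  · rw [mem_interlaceFull]
    refine ⟨fun i => ?_, fun i => ?_, by rw [hcl]; omega⟩
    · apply hcomp
      rw [← hrow, ← hzs']
      exact hzp.interlace_right _ _ ⟨by omega, by omega, by omega, by omega⟩
        ⟨by omega, by omega, by omega, by omega⟩
    · have h1 := hzp.interlace_left (2 * n + 1) (i + 1) ⟨by omega, by omega, by omega, by omega⟩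
        ⟨by omega, by omega, by omega, by omega⟩
      rw [hc', ← Fin.val_succ, hzs'] at h1
      rw [hcc]
      have : (a i.succ : ℚ) ≤ c' i := by linarith
      exact_mod_cast this
  · rw [mem_interlaceShort]
    refine fun i => ⟨hcomp _ _ ?_, ?_⟩
    · have h1 := hzp.interlace_left (2 * n) (i + 1) ⟨by have := i.isLt; omega, by omega, by omega, by omega⟩
        ⟨by omega, by omega, by omega, by omega⟩
      rw [hb, ← Fin.val_succ, hrow] at h1
      exact_mod_cast h1
    · have h1 := hzp.interlace_right (2 * n) (i + 1) ⟨by have := i.isLt; omega, by omega, by omega, by omega⟩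
        ⟨by omega, by omega, by omega, by omega⟩
      rw [hb, hc'] at h1
      rw [hcc]
      have : (b i : ℚ) ≤ c' i := by linarith
      exact_mod_cast this
  · intro i j hij
    split_ifs with h
    · exact hzp.eq_zero_outside i j (by unfold InHalfTriangle at hij ⊢; omega)
    · rfl
  · rintro i j ⟨h1, h2, h3, h4⟩ ho
    simpa [h2] using hzp.odd_end i j ⟨h1, by omega, h3, h4⟩ ho
  · rcases hzp.same_kind with h | h
    · refine Or.inl ?_
      rintro i j ⟨h1, h2, h3, h4⟩ ho
      simpa [h2] using h i j ⟨h1, by omega, h3, h4⟩ ho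
    · refine Or.inr ?_
      rintro i j ⟨h1, h2, h3, h4⟩ ho
      simpa [h2] using h i j ⟨h1, by omega, h3, h4⟩ ho
  · rintro i j ⟨h1, h2, h3, h4⟩ ⟨h1', h2', h3', h4'⟩
    simpa [h2, h2'] using hzp.interlace_left i j ⟨h1, by omega, h3, h4⟩ ⟨h1', by omega, h3', h4'⟩
  · rintro i j ⟨h1, h2, h3, h4⟩ ⟨h1', h2', h3', h4'⟩
    simpa [h2, h2'] using hzp.interlace_right i j ⟨h1, by omega, h3, h4⟩ ⟨h1', by omega, h3', h4'⟩
  · intro j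
    simp [hb, halfShift]
  · funext i j
    rcases (by omega : i ≤ 2 * n ∨ i = 2 * n + 1 ∨ i = 2 * n + 2 ∨ 2 * n + 2 < i) with
      h | rfl | rfl | h
    · simp [extendPattern, h]
    · rw [extendPattern_odd]
      by_cases hj : 1 ≤ j ∧ j ≤ n + 1
      · obtain ⟨k, rfl⟩ : ∃ k : Fin (n + 1), j = k + 1 := ⟨⟨j - 1, by omega⟩, by simp; omega⟩
        rw [rowOf_succ, hrow]
      · rw [rowOf_outside _ hj, hzp.eq_zero_outside _ _ (by unfold InHalfTriangle; omega)]
    · rw [extendPattern_even]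
      by_cases hj : 1 ≤ j ∧ j ≤ n + 1
      · obtain ⟨k, rfl⟩ : ∃ k : Fin (n + 1), j = k + 1 := ⟨⟨j - 1, by omega⟩, by simp; omega⟩
        rw [rowOf_succ, hzs', halfShift]
      · rw [rowOf_outside _ hj, hzp.eq_zero_outside _ _ (by unfold InHalfTriangle; omega)]
    · rw [hzp.eq_zero_outside _ _ (by unfold InHalfTriangle; omega)]
      simp only [extendPattern]
      rw [if_neg (by omega), if_neg (by omega), if_neg (by omega)]

/-! ### Row sums, atypical entries and exponents of an extended pattern. -/

theorem sum_Icc_one_eq_sum_fin {M : Type*} [AddCommMonoid M] (m : ℕ) (g : ℕ → M) :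
    ∑ j ∈ Finset.Icc 1 m, g j = ∑ i : Fin m, g (i + 1) := by
  rw [Fin.sum_univ_eq_sum_range (fun i => g (i + 1)), Finset.range_eq_Ico, Finset.sum_Ico_add' g]
  exact Finset.sum_congr (by ext; simp only [Finset.mem_Icc, Finset.mem_Ico]; omega) fun _ _ => rfl

theorem rowSum_even (z : ℕ → ℕ → ℚ) (n : ℕ) : rowSum z (2 * n) = ∑ i : Fin n, z (2 * n) (i + 1) := by
  rw [rowSum, show (2 * n + 1) / 2 = n by omega, sum_Icc_one_eq_sum_fin]

theorem rowSum_odd (z : ℕ → ℕ → ℚ) (n : ℕ) :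
    rowSum z (2 * n + 1) = ∑ i : Fin (n + 1), z (2 * n + 1) (i + 1) := by
  rw [rowSum, show (2 * n + 1 + 1) / 2 = n + 1 by omega, sum_Icc_one_eq_sum_fin]

theorem patternExponent_eq (z : ℕ → ℕ → ℚ) (i : ℕ) :
    patternExponent z i =
      rowSum z (2 * (i + 1)) - 2 * rowSum z (2 * i + 1) + rowSum z (2 * i) := by
  have h1 : 2 * (i + 1) - 1 = 2 * i + 1 := by omega
  have h2 : 2 * i + 1 - 1 = 2 * i := by omega
  rw [patternExponent, patternType, patternType, h1, h2]
  ring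

open Classical in
theorem atypCount_succ (n : ℕ) (z : ℕ → ℕ → ℚ) :
    atypCount (n + 1) z =
      ((Finset.Icc 1 n).filter fun i => IsAtypical (n + 1) z (2 * i - 1) i).card +
        if IsAtypical (n + 1) z (2 * n + 1) (n + 1) then 1 else 0 := by
  rw [atypCount, Finset.card_filter, Finset.card_filter, Finset.sum_Icc_succ_top (by omega)]
  rw [show 2 * (n + 1) - 1 = 2 * n + 1 by omega]

section extend
variable {n d : ℕ} {a c : Fin (n + 1) → ℤ} {b : Fin n → ℤ} {s : ℕ} {z : ℕ → ℕ → ℚ}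

/-- Atypicality depends only on the class of the bottom row, which is that of `d` in both patterns;
only the new odd end can add to the count. -/
theorem atypCount_extendPattern (hd : d ≤ 1) (hs : s ≤ 1) (hz : z ∈ splitPatterns (halfShift d b)) :
    atypCount (n + 1) (extendPattern n z (oddRow d c s) (halfShift d a)) = atypCount n z + s := by
  classical
  have hk : extendPattern n z (oddRow d c s) (halfShift d a) (2 * (n + 1)) 1 = a 0 + d / 2 := by
    rw [show 2 * (n + 1) = 2 * n + 2 by ring, extendPattern_even]
    exact rowOf_succ _ 0
  rw [atypCount_succ]
  congr 1
  · rw [atypCount]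
    congr 1
    refine Finset.filter_congr fun i hi => ?_
    rw [Finset.mem_Icc] at hi
    have hn : 0 < n := by omega
    rw [isAtypical_iff hd hk, extendPattern_of_le _ _ _ (by omega),
      isAtypical_iff hd (k := b ⟨0, hn⟩) (by simpa [halfShift] using hz.2 ⟨0, hn⟩)]
  · have h1 : extendPattern n z (oddRow d c s) (halfShift d a) (2 * n + 1) (n + 1) =
        c (Fin.last n) + d / 2 - s / 2 := by
      rw [extendPattern_odd]
      refine (rowOf_succ _ (Fin.last n)).trans ?_
      simp [oddRow]
    rw [isAtypical_iff hd hk, h1]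
    interval_cases s
    · rw [if_neg]
      rintro ⟨m, hm⟩
      exact int_ne_int_add_half m (c (Fin.last n)) (by push_cast at hm ⊢; linarith)
    · rw [if_pos]
      exact ⟨c (Fin.last n), by simp⟩

theorem patternExponent_extendPattern_of_lt {i : ℕ} (hi : i < n) (κ lam : Fin (n + 1) → ℚ) :
    patternExponent (extendPattern n z κ lam) i = patternExponent z i := by
  have h : ∀ r ≤ 2 * n, rowSum (extendPattern n z κ lam) r = rowSum z r := fun r hr =>
    Finset.sum_congr rfl fun j _ => extendPattern_of_le _ _ _ hr j
  rw [patternExponent_eq, patternExponent_eq, h _ (by omega), h _ (by omega), h _ (by omega)]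

/-- The exponent is a second difference of row sums. The shifts `d/2` occur `(n+1) - 2(n+1) + n =
-1` times, and the lowering of the odd end by `s/2` enters with factor `-2`, hence as `+s`. -/
theorem patternExponent_extendPattern_last (hz : z ∈ splitPatterns (halfShift d b)) :
    patternExponent (extendPattern n z (oddRow d c s) (halfShift d a)) n =
      -(d : ℚ) / 2 + s + ((∑ i, a i : ℤ) - 2 * (∑ i, c i : ℤ) + (∑ i, b i : ℤ)) := by
  rw [patternExponent_eq, rowSum_even, rowSum_odd, rowSum_even]
  have h1 : ∀ i : Fin (n + 1), extendPattern n z (oddRow d c s) (halfShift d a)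
      (2 * (n + 1)) (i + 1) = a i + d / 2 := fun i => by
    rw [show 2 * (n + 1) = 2 * n + 2 by ring, extendPattern_even, rowOf_succ, halfShift]
  have h2 : ∀ i : Fin (n + 1), extendPattern n z (oddRow d c s) (halfShift d a)
      (2 * n + 1) (i + 1) = oddRow d c s i := fun i => by
    rw [extendPattern_odd, rowOf_succ]
  have h3 : ∀ i : Fin n, extendPattern n z (oddRow d c s) (halfShift d a)
      (2 * n) (i + 1) = b i + d / 2 := fun i => by
    rw [extendPattern_of_le _ _ _ le_rfl, hz.2, halfShift]
  simp only [h1, h2, h3, oddRow, Finset.sum_add_distrib, Finset.sum_sub_distrib,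
    Finset.sum_ite_eq', Finset.mem_univ, if_true, Finset.sum_const, Finset.card_univ,
    Fintype.card_fin, nsmul_eq_mul]
  push_cast
  ring

end extend

theorem extendPattern_injective {n d : ℕ} {a c c' : Fin (n + 1) → ℤ}
    {b b' : Fin n → ℤ} {s s' : ℕ} {z z' : ℕ → ℕ → ℚ}
    (hs : s ≤ 1) (hs' : s' ≤ 1)
    (hz : z ∈ splitPatterns (halfShift d b)) (hz' : z' ∈ splitPatterns (halfShift d b'))
    (h : extendPattern n z (oddRow d c s) (halfShift d a) =
      extendPattern n z' (oddRow d c' s') (halfShift d a)) :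
    c = c' ∧ b = b' ∧ s = s' ∧ z = z' := by
  have hzz : z = z' := by
    funext i j
    by_cases hi : i ≤ 2 * n
    · have := congrFun (congrFun h i) j
      rwa [extendPattern_of_le _ _ _ hi, extendPattern_of_le _ _ _ hi] at this
    · rw [hz.1.eq_zero_outside _ _ (by unfold InHalfTriangle; omega),
        hz'.1.eq_zero_outside _ _ (by unfold InHalfTriangle; omega)]
  have hbb : b = b' := by
    funext j
    have h1 := hz.2 j
    rw [hzz, hz'.2 j] at h1
    simp only [halfShift] at h1
    have : (b' j : ℚ) = b j := by linarith
    exact_mod_cast this.symm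
  have hrow : ∀ j, oddRow d c s j = oddRow d c' s' j := fun j => by
    have := congrFun (congrFun h (2 * n + 1)) (j + 1)
    rwa [extendPattern_odd, extendPattern_odd, rowOf_succ, rowOf_succ] at this
  -- Since `s ≤ 1`, the integer `2c - s` determines both `c` and `s`.
  have hlast : s = s' ∧ c (Fin.last n) = c' (Fin.last n) := by
    have := hrow (Fin.last n)
    simp only [oddRow, if_true] at this
    have : (2 * c (Fin.last n) - s : ℚ) = 2 * c' (Fin.last n) - s' := by linarith
    have : (2 * c (Fin.last n) - s : ℤ) = 2 * c' (Fin.last n) - s' := by exact_mod_cast this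
    omega
  refine ⟨?_, hbb, hlast.1, hzz⟩
  funext j
  induction j using Fin.lastCases with
  | last => exact hlast.2
  | cast j =>
    have := hrow j.castSucc
    simp only [oddRow, (Fin.castSucc_lt_last j).ne, if_false] at this
    have : (c j.castSucc : ℚ) = c' j.castSucc := by linarith
    exact_mod_cast this

/-- The branching rule for pattern sums. -/
theorem patternSum_branching {A : Type*} [CommRing A] [Algebra ℂ A] {n d : ℕ} (hd : d ≤ 1)
    (a : Fin (n + 1) → ℤ) (β : ℂ) (x : Fin (n + 1) → ℚ → A) (hx : IsPow (x (Fin.last n))) :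
    patternSum (halfShift d a) β x =
      ∑ c ∈ interlaceFull a, ∑ b ∈ interlaceShort c,
        (if c (Fin.last n) = 0 then (if d = 0 then 1 else 1 + β • x (Fin.last n) 1)
          else 1 + β • x (Fin.last n) 1) * x (Fin.last n) (-(d : ℚ) / 2) *
        x (Fin.last n) ((∑ i, a i : ℤ) - 2 * (∑ i, c i : ℤ) + (∑ i, b i : ℤ)) *
        patternSum (halfShift d b) β fun j => x j.castSucc := by
  classical
  -- The admissible choices for the odd end: both, unless `c` ends in `0` and `d = 0`, when only the
  -- typical one remains.
  let S : (Fin (n + 1) → ℤ) → Finset ℕ := fun c =>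
    (Finset.range 2).filter fun s => (s : ℤ) ≤ 2 * c (Fin.last n) + d
  have hS : ∀ c s, s ∈ S c ↔ s ≤ 1 ∧ (s : ℤ) ≤ 2 * c (Fin.last n) + d := fun c s => by
    simp only [S, Finset.mem_filter, Finset.mem_range]; omega
  let y := x (Fin.last n)
  have key : patternSum (halfShift d a) β x =
      ∑ c ∈ interlaceFull a, ∑ b ∈ interlaceShort c, ∑ s ∈ S c,
        ∑ z ∈ (splitPatterns_finite (halfShift d b)).toFinset,
          β ^ (atypCount n z + s) • ((∏ i : Fin n, x i.castSucc (patternExponent z i)) *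
            y (-(d : ℚ) / 2 + s + ((∑ i, a i : ℤ) - 2 * (∑ i, c i : ℤ) + (∑ i, b i : ℤ)))) := by
    simp only [Finset.sum_sigma']
    symm
    refine Finset.sum_bij
      (fun p _ => extendPattern n p.2.2.2 (oddRow d p.1 p.2.2.1) (halfShift d a)) ?_ ?_ ?_ ?_
    · rintro ⟨c, b, s, z⟩ hp
      simp only [Finset.mem_sigma, Set.Finite.mem_toFinset, hS] at hp ⊢
      obtain ⟨hc, hb, ⟨hs, hsc⟩, hz⟩ := hp
      exact extendPattern_mem hd hs hc hb hsc hz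
    · rintro ⟨c, b, s, z⟩ hp ⟨c', b', s', z'⟩ hp' h
      simp only [Finset.mem_sigma, Set.Finite.mem_toFinset, hS] at hp hp' h
      obtain ⟨rfl, rfl, rfl, rfl⟩ :=
        extendPattern_injective hp.2.2.1.1 hp'.2.2.1.1 hp.2.2.2 hp'.2.2.2 h
      rfl
    · intro z hz
      rw [Set.Finite.mem_toFinset] at hz
      obtain ⟨c, hc, b, hb, s, hs, hsc, z', hz', rfl⟩ := exists_extendPattern hd hz
      refine ⟨⟨c, b, s, z'⟩, ?_, rfl⟩
      simp only [Finset.mem_sigma, Set.Finite.mem_toFinset, hS]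
      exact ⟨hc, hb, ⟨hs, hsc⟩, hz'⟩
    · rintro ⟨c, b, s, z⟩ hp
      simp only [Finset.mem_sigma, Set.Finite.mem_toFinset, hS] at hp
      obtain ⟨hc, hb, ⟨hs, hsc⟩, hz⟩ := hp
      rw [atypCount_extendPattern hd hs hz, Fin.prod_univ_castSucc]
      congr 2
      · refine Finset.prod_congr rfl fun i _ => ?_
        rw [Fin.val_castSucc, patternExponent_extendPattern_of_lt i.isLt]
      · rw [Fin.val_last, patternExponent_extendPattern_last hz]
  rw [key]
  refine Finset.sum_congr rfl fun c hc => Finset.sum_congr rfl fun b _ => ?_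
  have hw : (if c (Fin.last n) = 0 then (if d = 0 then 1 else 1 + β • y 1) else 1 + β • y 1) =
      ∑ s ∈ S c, β ^ s • y s := by
    have hc0 := (mem_interlaceFull.1 hc).2.2
    by_cases h : c (Fin.last n) = 0 ∧ d = 0
    · have : S c = {0} := by
        ext s; rw [hS, Finset.mem_singleton]; omega
      rw [if_pos h.1, if_pos h.2, this]
      simp [y, hx.zero]
    · have : S c = {0, 1} := by
        ext s; rw [hS, Finset.mem_insert, Finset.mem_singleton]; omega
      rw [this, Finset.sum_pair (by norm_num)]
      have h' : (if c (Fin.last n) = 0 then (if d = 0 then 1 else 1 + β • y 1)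
          else 1 + β • y 1) = 1 + β • y 1 := by
        split_ifs with h1 h2
        · exact absurd ⟨h1, h2⟩ h
        · rfl
        · rfl
      rw [h']
      simp [y, hx.zero]
  change _ = (if c (Fin.last n) = 0 then (if d = 0 then 1 else 1 + β • y 1)
    else 1 + β • y 1) * _ * _ * _
  rw [hw, patternSum, Finset.sum_mul, Finset.sum_mul, Finset.sum_mul]
  refine Finset.sum_congr rfl fun s _ => ?_
  rw [Finset.mul_sum]
  refine Finset.sum_congr rfl fun z _ => ?_
  simp only [y]
  rw [hx.add, hx.add, pow_add, mul_smul]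
  simp only [Algebra.smul_def]
  ring

/-! ### The bialternant formula over arbitrary algebras -/

/-- The function `x ↦ x ^ k - x ^ (-k) + β (x ^ (k - 1) - x ^ (1 - k))` for `d = 0`, and
`x ↦ (β x ^ (1 / 2) + x ^ (-1 / 2)) (x ^ k - x ^ (-k))` otherwise. -/
def alternantFun {A : Type*} [CommRing A] [Algebra ℂ A] (d : ℕ) (β : ℂ) (x : ℚ → A) (k : ℤ) : A :=
  if d = 0 then x k - x (-k) + β • (x (k - 1) - x (-(k - 1)))
  else (β • x (1 / 2) + x (-(1 / 2))) * (x k - x (-k))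

/-- The alternant with exponents `aᵢ + n - i + 1`, where `1 ≤ i ≤ n`. -/
def alternant {A : Type*} [CommRing A] [Algebra ℂ A] (d : ℕ) (β : ℂ) {n : ℕ} (a : Fin n → ℤ)
    (x : Fin n → ℚ → A) : A :=
  (Matrix.of fun i j : Fin n => alternantFun d β (x j) (a i + n - i)).det

/-- The type C Weyl denominator. -/
def weylDenom {A : Type*} [CommRing A] [Algebra ℂ A] {n : ℕ} (x : Fin n → ℚ → A) : A :=
  alternant 0 0 0 x

/-! ### Recurrence, boundary values and branching of the alternants. -/

section
variable {A : Type*} [CommRing A] [Algebra ℂ A]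

theorem alternantFun_rec {d : ℕ} (β : ℂ) {x : ℚ → A} (hx : IsPow x) (k : ℤ) :
    (x 1 + x (-1)) * alternantFun d β x k =
      alternantFun d β x (k + 1) + alternantFun d β x (k - 1) := by
  have h : ∀ q, (x 1 + x (-1)) * x q = x (q + 1) + x (q - 1) := fun q => by
    rw [sub_eq_add_neg, hx.add, hx.add]; ring
  have h' : ∀ q : ℚ, (x 1 + x (-1)) * (x q - x (-q)) =
      (x (q + 1) - x (-(q + 1))) + (x (q - 1) - x (-(q - 1))) := fun q => by
    rw [mul_sub, h, h, show -q + 1 = -(q - 1) by ring, show -q - 1 = -(q + 1) by ring]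
    ring
  unfold alternantFun
  split_ifs
  · push_cast
    rw [mul_add, h', mul_smul_comm, h', show (k : ℚ) - 1 + 1 = k + 1 - 1 by ring]
    simp only [smul_add, smul_sub]
    ring
  · push_cast
    rw [mul_left_comm, h', mul_add]

/-- For `d = 0` the value at `0` is `-β` times the value at `1`, so the bracket already carries the
factor `1 + βy`. For `d = 1` the value at `0` vanishes and the ordinary weight is right. This
matches the exceptional weight of patterns. -/
theorem alternantFun_init {d : ℕ} (β : ℂ) {x : ℚ → A} {y : ℚ → A} (hy : IsPow y) :
    (if d = 0 then 1 else 1 + β • y 1) *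
        (y 1 * alternantFun d β x 1 - y 2 * alternantFun d β x 0) =
      (1 + β • y 1) * (y 1 * alternantFun d β x 1) := by
  have h2 : y 2 = y 1 * y 1 := by rw [← hy.add]; norm_num
  unfold alternantFun
  split_ifs
  · simp only [h2, Algebra.smul_def]
    norm_num
    ring
  · simp

/-- For `d = 0` the function is `y^k (1 + βy⁻¹) - y^(-k) (1 + βy)`. The rescaling makes the first
term independent of `k`, so only the second survives in the difference. For `d = 1` one uses
`βy^(1/2) + y^(-1/2) = (1 + βy) y^(-1/2)`. -/
theorem alternantFun_last {d : ℕ} (hd : d ≤ 1) (β : ℂ) {y : ℚ → A} (hy : IsPow y) (k : ℤ) :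
    y (1 - k) * alternantFun d β y (k + 1) - y (2 - k) * alternantFun d β y k =
      (1 + β • y 1) * y (-(d : ℚ) / 2) * (y 2 - 1) * y (-2 * k) := by
  interval_cases d
  · simp only [alternantFun, if_true]
    push_cast
    simp only [mul_add, mul_sub, mul_smul_comm, ← hy.add, add_mul, sub_mul, smul_mul_assoc,
      mul_one, one_mul, smul_sub]
    ring_nf
  · simp only [alternantFun, one_ne_zero, if_false]
    push_cast
    simp only [mul_add, mul_sub, mul_smul_comm, ← hy.add, add_mul, sub_mul, smul_mul_assoc,
      mul_one, one_mul]
    ring_nf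

/-- The factor by which the Weyl denominator grows with the number of variables. -/
def weylFactor {n : ℕ} (x : Fin (n + 1) → ℚ → A) : A :=
  (x (Fin.last n) 1 - x (Fin.last n) (-1)) *
    ∏ j : Fin n, (x j.castSucc 1 + x j.castSucc (-1) - x (Fin.last n) 1 - x (Fin.last n) (-1))

/-- The sum has the same weights as `patternSum_branching`, while `weylFactor x` involves none of
`a`, `β`, `d`. -/
theorem alternant_branching {d n : ℕ} (hd : d ≤ 1) (β : ℂ) {a : Fin (n + 1) → ℤ} (ha : Antitone a)
    (ha0 : 0 ≤ a (Fin.last n)) {x : Fin (n + 1) → ℚ → A} (hx : ∀ i, IsPow (x i))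
    (hu : ∀ r s, (1 + β • x (Fin.last n) 1) * r = (1 + β • x (Fin.last n) 1) * s → r = s) :
    alternant d β a x = weylFactor x *
      ∑ c ∈ interlaceFull a, ∑ b ∈ interlaceShort c,
        (if c (Fin.last n) = 0 then (if d = 0 then 1 else 1 + β • x (Fin.last n) 1)
          else 1 + β • x (Fin.last n) 1) * x (Fin.last n) (-(d : ℚ) / 2) *
        x (Fin.last n) ((∑ i, a i : ℤ) - 2 * (∑ i, c i : ℤ) + (∑ i, b i : ℤ)) *
        alternant d β b fun j => x j.castSucc := by
  have := det_branching (hx (Fin.last n)) (fun j => alternantFun d β (x j))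
    (fun j => x j.castSucc 1 + x j.castSucc (-1)) hu
    (fun j k => alternantFun_rec β (hx _) k) (fun k => alternantFun_last hd β (hx _) k)
    (fun j => alternantFun_init β (hx _)) ha ha0
  refine Eq.trans ?_ this
  unfold alternant
  congr 1
  ext i j
  simp only [Matrix.of_apply]
  congr 1
  push_cast
  ring

/-- The zero partition interlaces only with zero vectors, so for `β = 0` the branching sum reduces
to a single term of weight `1`. -/
theorem weylDenom_succ {n : ℕ} {x : Fin (n + 1) → ℚ → A} (hx : ∀ i, IsPow (x i)) :
    weylDenom x = weylFactor x * weylDenom fun j => x j.castSucc := by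
  have h := alternant_branching (d := 0) zero_le_one 0 (a := (0 : Fin (n + 1) → ℤ))
    (fun _ _ _ => le_rfl) le_rfl hx (fun r s h => by simpa using h)
  have h1 : interlaceFull (0 : Fin (n + 1) → ℤ) = {0} := by
    ext c
    rw [mem_interlaceFull, Finset.mem_singleton]
    constructor
    · rintro ⟨h1, h2, h3⟩
      funext i
      induction i using Fin.lastCases with
      | last => exact le_antisymm (h1 _) h3
      | cast i => exact le_antisymm (h1 _) (h2 i)
    · rintro rfl; simp
  have h2 : interlaceShort (0 : Fin (n + 1) → ℤ) = {0} := by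
    ext b
    rw [mem_interlaceShort, Finset.mem_singleton]
    constructor
    · intro h
      funext i
      exact le_antisymm (h i).2 (h i).1
    · rintro rfl; simp
  rw [weylDenom, h, h1, Finset.sum_singleton, h2, Finset.sum_singleton]
  simp [(hx (Fin.last n)).zero, weylDenom]

theorem weylDenom_eq_prod {n : ℕ} {x : Fin n → ℚ → A} (hx : ∀ i, IsPow (x i)) :
    weylDenom x = (∏ i, (x i 1 - x i (-1))) *
      ∏ i, ∏ j ∈ Finset.Ioi i, (x i 1 + x i (-1) - x j 1 - x j (-1)) := by
  induction n with
  | zero => simp [weylDenom, alternant]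
  | succ n ih =>
    rw [weylDenom_succ hx, ih fun i => hx i.castSucc, weylFactor]
    have h : ∀ (m : ℕ) (g : Fin m → Fin m → A),
        ∏ i, ∏ j ∈ Finset.Ioi i, g i j = ∏ i, ∏ j, if i < j then g i j else 1 := fun m g =>
      Finset.prod_congr rfl fun i _ => by
        rw [← Finset.prod_filter]; congr 1; ext; simp
    rw [h, h, Fin.prod_univ_castSucc, Fin.prod_univ_castSucc (f := fun i : Fin (n + 1) => ∏ j, _)]
    simp only [Fin.prod_univ_castSucc (n := n), Fin.castSucc_lt_castSucc_iff, Fin.castSucc_lt_last,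
      if_true, Finset.prod_mul_distrib]
    have h' : ∀ j : Fin n, ¬ Fin.last n < j.castSucc := fun j => (Fin.castSucc_lt_last j).le.not_gt
    simp only [h', if_false, lt_irrefl, Finset.prod_const_one, mul_one]
    ring

theorem patternSum_zero (lam : Fin 0 → ℚ) (β : ℂ) (x : Fin 0 → ℚ → A) :
    patternSum lam β x = 1 := by
  have h : (splitPatterns_finite lam).toFinset = {fun _ _ => 0} := by
    ext z
    rw [Set.Finite.mem_toFinset, Finset.mem_singleton]
    have hno : ∀ i j, ¬ InHalfTriangle 0 i j := by
      rintro i j ⟨h1, h2, -⟩; omega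
    constructor
    · rintro ⟨hz, -⟩
      funext i j
      exact hz.eq_zero_outside i j (hno i j)
    · rintro rfl
      refine ⟨⟨fun _ _ _ => rfl, fun i j h => absurd h (hno i j),
        Or.inl fun i j h => absurd h (hno i j), fun i j h => absurd h (hno i j),
        fun i j h => absurd h (hno i j)⟩, fun j => j.elim0⟩
  rw [patternSum, h, Finset.sum_singleton]
  simp [atypCount]

/-- The bialternant formula. -/
theorem patternSum_mul_weylDenom {d n : ℕ} (hd : d ≤ 1) (β : ℂ) {a : Fin n → ℤ} (ha : Antitone a)
    (ha0 : ∀ i, 0 ≤ a i) {x : Fin n → ℚ → A} (hx : ∀ i, IsPow (x i))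
    (hu : ∀ i r s, (1 + β • x i 1) * r = (1 + β • x i 1) * s → r = s) :
    patternSum (halfShift d a) β x * weylDenom x = alternant d β a x := by
  induction n with
  | zero => simp [patternSum_zero, weylDenom, alternant]
  | succ n ih =>
    rw [patternSum_branching hd a β x (hx _), weylDenom_succ hx,
      alternant_branching hd β ha (ha0 _) hx (hu _), Finset.sum_mul, Finset.mul_sum]
    refine Finset.sum_congr rfl fun c hc => ?_
    rw [Finset.sum_mul, Finset.mul_sum]
    refine Finset.sum_congr rfl fun b hb => ?_
    -- Interlacing forces `b` to be decreasing and nonnegative again, so the induction hypothesis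
    -- applies to it.
    obtain ⟨hc1, hc2, hc3⟩ := mem_interlaceFull.1 hc
    have hb' := mem_interlaceShort.1 hb
    have hca : Antitone c := Fin.antitone_iff_succ_le.2 fun i => (hb' i).1.trans (hb' i).2
    have hba : Antitone b := by
      intro i j hij
      rcases hij.eq_or_lt with rfl | hlt
      · exact le_rfl
      · exact (hb' j).2.trans ((hca (by
          rw [Fin.le_def]; rw [Fin.lt_def] at hlt; simp; omega)).trans (hb' i).1)
    have hb0 : ∀ i, 0 ≤ b i := fun i => (hc3.trans (hca (Fin.le_last _))).trans (hb' i).1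
    rw [← ih hba hb0 (fun i => hx i.castSucc) fun i => hu i.castSucc]
    ring

end

/-! ### The bialternant formula for Laurent polynomials with fractional exponents -/

theorem isPow_xpow {n : ℕ} (j : Fin n) : IsPow (xpow j) := by
  refine ⟨?_, fun p q => ?_⟩
  · simp [xpow, AddMonoidAlgebra.one_def]
  · simp [xpow, AddMonoidAlgebra.single_mul_single, Pi.single_add]

theorem coeff_xpow {n : ℕ} (j : Fin n) (q : ℚ) (v : Fin n → ℚ) :
    (xpow j q).coeff v = if Pi.single j q = v then 1 else 0 := by
  simp [xpow, Finsupp.single_apply]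

theorem single_eq_single_iff_of_ne_zero {n : ℕ} {i j : Fin n} {p q : ℚ} (hq : q ≠ 0) :
    (Pi.single i p : Fin n → ℚ) = Pi.single j q ↔ i = j ∧ p = q := by
  constructor
  · intro h
    have h1 := congrFun h j
    rw [Pi.single_eq_same] at h1
    by_cases hij : i = j
    · subst hij
      rw [Pi.single_eq_same] at h1
      exact ⟨rfl, h1⟩
    · rw [Pi.single_eq_of_ne (Ne.symm hij)] at h1
      exact absurd h1.symm hq
  · rintro ⟨rfl, rfl⟩; rfl

theorem one_add_smul_xpow_ne_zero {n : ℕ} (j : Fin n) (β : ℂ) {q : ℚ} (hq : q ≠ 0) :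
    1 + β • xpow j q ≠ 0 := by
  intro h
  have h1 := congrArg (fun f : FracLaurent n => f.coeff 0) h
  simp [coeff_xpow, AddMonoidAlgebra.one_def, hq] at h1

theorem weylDenom_xpow_ne_zero (n : ℕ) : weylDenom (A := FracLaurent n) xpow ≠ 0 := by
  rw [weylDenom_eq_prod isPow_xpow]
  refine mul_ne_zero (Finset.prod_ne_zero_iff.2 fun i _ h => ?_)
    (Finset.prod_ne_zero_iff.2 fun i _ => Finset.prod_ne_zero_iff.2 fun j hj h => ?_)
  -- In a domain it suffices that every factor is nonzero; in each of them the monomial `x_i` has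
  -- coefficient `1`.
  · have h1 := congrArg (fun f : FracLaurent n => f.coeff (Pi.single i 1)) h
    simp [coeff_xpow] at h1
    norm_num at h1
  · have hij : j ≠ i := (Finset.mem_Ioi.1 hj).ne'
    have h1 := congrArg (fun f : FracLaurent n => f.coeff (Pi.single i 1)) h
    simp [coeff_xpow, single_eq_single_iff_of_ne_zero, hij] at h1
    norm_num at h1

theorem transCB_mul_weylDenom {d n : ℕ} (hd : d ≤ 1) (β : ℂ) {a : Fin n → ℤ} (ha : Antitone a)
    (ha0 : ∀ i, 0 ≤ a i) :
    transCB (halfShift d a) β * weylDenom xpow = alternant d β a xpow :=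
  patternSum_mul_weylDenom hd β ha ha0 isPow_xpow fun i _ _ h =>
    mul_left_cancel₀ (one_add_smul_xpow_ne_zero i β one_ne_zero) h

theorem det_denomMatrix (n : ℕ) : (denomMatrix n).det = weylDenom xpow := by
  unfold weylDenom alternant denomMatrix
  congr 1
  ext1 i j
  simp only [Matrix.of_apply, alternantFun, if_true, zero_smul, add_zero, Pi.zero_apply]
  congr 2 <;> push_cast <;> ring

theorem det_numMatrix {n : ℕ} (a : Fin n → ℤ) (β : ℂ) :
    (numMatrix (halfShift 0 a) β).det = alternant 0 β a xpow := by
  unfold alternant numMatrix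
  congr 1
  ext1 i j
  simp only [Matrix.of_apply, alternantFun, if_true, halfShift]
  congr 2
  · congr 1; push_cast; ring
  · congr 1; push_cast; ring
  · congr 2 <;> push_cast <;> ring

theorem det_halfNumMatrix {n : ℕ} (a : Fin n → ℤ) (β : ℂ) :
    (halfNumMatrix (halfShift 1 a) β).det = alternant 1 β a xpow := by
  unfold alternant halfNumMatrix
  congr 1
  ext1 i j
  simp only [Matrix.of_apply, alternantFun, one_ne_zero, if_false, halfShift]
  congr 3 <;> push_cast <;> ring

theorem IsPartition.exists_halfShift {n : ℕ} {lam : Fin n → ℚ} (h : IsPartition lam) :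
    ∃ a : Fin n → ℤ, Antitone a ∧ (∀ i, 0 ≤ a i) ∧ lam = halfShift 0 a := by
  choose m hm using h.2
  refine ⟨fun i => m i, fun i j hij => ?_, fun i => by positivity, ?_⟩
  · have := h.1 hij
    rw [hm, hm] at this
    change (m j : ℤ) ≤ m i
    exact_mod_cast this
  · funext i; simp [halfShift, hm]

theorem IsHalfPartition.exists_halfShift {n : ℕ} {lam : Fin n → ℚ} (h : IsHalfPartition lam) :
    ∃ a : Fin n → ℤ, Antitone a ∧ (∀ i, 0 ≤ a i) ∧ lam = halfShift 1 a := by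
  choose m hm using h.2
  refine ⟨fun i => m i, fun i j hij => ?_, fun i => by positivity, ?_⟩
  · have := h.1 hij
    rw [hm, hm] at this
    have : (m j : ℚ) ≤ m i := by linarith
    change (m j : ℤ) ≤ m i
    exact_mod_cast this
  · funext i; simp [halfShift, hm]

theorem toFrac_eq_div {n : ℕ} {f g h : FracLaurent n} (hg : g ≠ 0) (hfg : f * g = h) :
    toFrac f = toFrac h / toFrac g := by
  have : toFrac g ≠ 0 := fun h0 =>
    hg ((map_eq_zero_iff _ (IsFractionRing.injective (FracLaurent n) _)).1 h0)
  rw [eq_div_iff this, ← hfg]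
  exact (map_mul _ _ _).symm

theorem toFrac_transCB_of_isPartition {n : ℕ} {lam : Fin n → ℚ} (β : ℂ) (h : IsPartition lam) :
    toFrac (transCB lam β) = toFrac (numMatrix lam β).det / toFrac (denomMatrix n).det := by
  obtain ⟨a, ha, ha0, rfl⟩ := h.exists_halfShift
  rw [det_denomMatrix, det_numMatrix]
  exact toFrac_eq_div (weylDenom_xpow_ne_zero n) (transCB_mul_weylDenom zero_le_one β ha ha0)

theorem toFrac_transCB_of_isHalfPartition {n : ℕ} {lam : Fin n → ℚ} (β : ℂ)
    (h : IsHalfPartition lam) :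
    toFrac (transCB lam β) = toFrac (halfNumMatrix lam β).det / toFrac (denomMatrix n).det := by
  obtain ⟨a, ha, ha0, rfl⟩ := h.exists_halfShift
  rw [det_denomMatrix, det_halfNumMatrix]
  exact toFrac_eq_div (weylDenom_xpow_ne_zero n) (transCB_mul_weylDenom le_rfl β ha ha0)

/-! ### Symmetry -/

theorem alternantFun_neg {A : Type*} [CommRing A] [Algebra ℂ A] (β : ℂ) (x : ℚ → A) (k : ℤ) :
    alternantFun 0 β (fun q => x (-q)) k = -alternantFun 0 β x k := by
  simp only [alternantFun, if_true, neg_neg, Algebra.smul_def]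
  ring

theorem alternant_comp_perm {A : Type*} [CommRing A] [Algebra ℂ A] (d : ℕ) (β : ℂ) {n : ℕ}
    (a : Fin n → ℤ) (x : Fin n → ℚ → A) (σ : Equiv.Perm (Fin n)) :
    alternant d β a (fun j => x (σ j)) = (Equiv.Perm.sign σ : ℤ) * alternant d β a x :=
  Matrix.det_permute' σ (Matrix.of fun i j : Fin n => alternantFun d β (x j) (a i + n - i))

theorem alternant_update_neg {A : Type*} [CommRing A] [Algebra ℂ A] (β : ℂ) {n : ℕ}
    (a : Fin n → ℤ) (x : Fin n → ℚ → A) (i : Fin n) :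
    alternant 0 β a (Function.update x i fun q => x i (-q)) = -1 * alternant 0 β a x := by
  let M : Matrix (Fin n) (Fin n) A := Matrix.of fun k j => alternantFun 0 β (x j) (a k + n - k)
  have h : (Matrix.of fun k j =>
      alternantFun 0 β (Function.update x i (fun q => x i (-q)) j) (a k + n - k)) =
      M.updateCol i ((-1 : A) • M.col i) := by
    ext k j
    by_cases hj : j = i
    · subst hj; simp [M, alternantFun_neg, Matrix.col]
    · simp [M, hj]
  rw [alternant, h, Matrix.det_updateCol_smul]
  congr 2
  ext k j
  by_cases hj : j = i
  · subst hj; simp [M, Matrix.col]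
  · simp [M, hj]

/-- A substitution that multiplies every alternant by the same `ε` also multiplies the Weyl
denominator by it, the case `γ = 0`, `b = 0`; the quotient is unchanged. -/
theorem patternSum_eq_of_alternant {n : ℕ} (β : ℂ) {a : Fin n → ℤ} (ha : Antitone a)
    (ha0 : ∀ i, 0 ≤ a i) {x : Fin n → ℚ → FracLaurent n} (hx : ∀ i, IsPow (x i))
    (hu : ∀ i, 1 + β • x i 1 ≠ 0) {ε : FracLaurent n} (hε : ε ≠ 0)
    (h : ∀ (γ : ℂ) (b : Fin n → ℤ), alternant 0 γ b x = ε * alternant 0 γ b xpow) :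
    patternSum (halfShift 0 a) β x = transCB (halfShift 0 a) β := by
  have h1 := patternSum_mul_weylDenom zero_le_one β ha ha0 hx
    fun i _ _ h => mul_left_cancel₀ (hu i) h
  rw [weylDenom, h, h, ← transCB_mul_weylDenom zero_le_one β ha ha0] at h1
  refine mul_right_cancel₀ (mul_ne_zero hε (weylDenom_xpow_ne_zero n)) (h1.trans ?_)
  ring

theorem map_patternSum {A B : Type*} [CommRing A] [Algebra ℂ A] [CommRing B] [Algebra ℂ B] {n : ℕ}
    (φ : A →ₐ[ℂ] B) (lam : Fin n → ℚ) (β : ℂ) (x : Fin n → ℚ → A) :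
    φ (patternSum lam β x) = patternSum lam β fun j q => φ (x j q) := by
  simp [patternSum, map_sum, map_prod]

/-- Permuting exponents is an algebra automorphism sending `x_j` to `x_(σ j)`; it multiplies all
alternants by the sign of `σ`. -/
theorem coeff_transCB_comp_perm {n : ℕ} (β : ℂ) {a : Fin n → ℤ} (ha : Antitone a)
    (ha0 : ∀ i, 0 ≤ a i) (σ : Equiv.Perm (Fin n)) (v : Fin n → ℚ) :
    (transCB (halfShift 0 a) β).coeff (v ∘ σ) = (transCB (halfShift 0 a) β).coeff v := by
  let e : (Fin n → ℚ) ≃+ (Fin n → ℚ) :=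
    { Equiv.piCongrLeft' (fun _ => ℚ) σ with map_add' := fun _ _ => rfl }
  have he : ∀ w : Fin n → ℚ, e w = w ∘ σ.symm := fun w => rfl
  have hes : ∀ w : Fin n → ℚ, e.symm w = w ∘ σ := fun w => by
    rw [AddEquiv.symm_apply_eq, he]; funext i; simp
  have hx : ∀ (j : Fin n) (q : ℚ),
      AddMonoidAlgebra.domCongr ℂ ℂ e (xpow j q) = xpow (σ j) q := fun j q => by
    rw [xpow, AddMonoidAlgebra.domCongr_single, he, xpow]
    congr 1
    funext i
    simp [Pi.single_apply, Equiv.symm_apply_eq]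
  have h1 := map_patternSum (AddMonoidAlgebra.domCongr ℂ ℂ e).toAlgHom (halfShift 0 a) β xpow
  have h2 : AddMonoidAlgebra.domCongr ℂ ℂ e (transCB (halfShift 0 a) β) =
      transCB (halfShift 0 a) β := by
    refine h1.trans ?_
    simp only [AlgEquiv.toAlgHom_apply, hx]
    refine patternSum_eq_of_alternant β ha ha0 (fun i => isPow_xpow _)
      (fun i => one_add_smul_xpow_ne_zero _ β one_ne_zero) (ε := ((Equiv.Perm.sign σ : ℤ) : _))
      ?_ fun γ b => alternant_comp_perm 0 γ b xpow σ
    rcases Int.units_eq_one_or (Equiv.Perm.sign σ) with h | h <;> simp [h]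
  have h3 := congrArg (fun f : FracLaurent n => f.coeff v) h2
  simp only [AddMonoidAlgebra.coeff_domCongr, hes] at h3
  exact h3

theorem coeff_transCB_update_neg {n : ℕ} (β : ℂ) {a : Fin n → ℤ} (ha : Antitone a)
    (ha0 : ∀ i, 0 ≤ a i) (k : Fin n) (v : Fin n → ℚ) :
    (transCB (halfShift 0 a) β).coeff (Function.update v k (-v k)) =
      (transCB (halfShift 0 a) β).coeff v := by
  let f : (Fin n → ℚ) → (Fin n → ℚ) := fun v => Function.update v k (-v k)
  have hf : ∀ v i, f v i = if i = k then -v i else v i := fun v i => by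
    by_cases h : i = k
    · subst h; simp [f]
    · simp [f, h]
  have hff : ∀ v, f (f v) = v := fun v => by
    funext i; rw [hf, hf]; split_ifs <;> simp
  let e : (Fin n → ℚ) ≃+ (Fin n → ℚ) :=
    { toFun := f, invFun := f, left_inv := hff, right_inv := hff
      map_add' := fun v w => by
        funext i; rw [Pi.add_apply, hf, hf, hf, Pi.add_apply]; split_ifs <;> ring }
  have hx : ∀ (j : Fin n) (q : ℚ), AddMonoidAlgebra.domCongr ℂ ℂ e (xpow j q) =
      Function.update xpow k (fun q => xpow k (-q)) j q := fun j q => by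
    rw [xpow, AddMonoidAlgebra.domCongr_single]
    have he : e (Pi.single j q) = Pi.single j (if j = k then -q else q) := by
      funext i
      refine (hf _ i).trans ?_
      by_cases hij : i = j
      · subst hij; simp
      · simp [hij]
    rw [he]
    by_cases hj : j = k
    · subst hj; simp [xpow]
    · simp [hj, xpow]
  have h1 := map_patternSum (AddMonoidAlgebra.domCongr ℂ ℂ e).toAlgHom (halfShift 0 a) β xpow
  have h2 : AddMonoidAlgebra.domCongr ℂ ℂ e (transCB (halfShift 0 a) β) =
      transCB (halfShift 0 a) β := by
    refine h1.trans ?_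
    simp only [AlgEquiv.toAlgHom_apply, hx]
    refine patternSum_eq_of_alternant β ha ha0 (fun i => ?_) (fun i => ?_) (ε := -1)
      (by simp) fun γ b => alternant_update_neg γ b xpow k
    · by_cases hi : i = k
      · subst hi
        simp only [Function.update_self]
        exact ⟨by simp [(isPow_xpow i).zero], fun p q => by rw [neg_add, (isPow_xpow i).add]⟩
      · rw [Function.update_of_ne hi]; exact isPow_xpow i
    · by_cases hi : i = k
      · subst hi
        simp only [Function.update_self]
        exact one_add_smul_xpow_ne_zero _ β (by norm_num)
      · rw [Function.update_of_ne hi]; exact one_add_smul_xpow_ne_zero _ β one_ne_zero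
  have h3 := congrArg (fun f : FracLaurent n => f.coeff v) h2
  simp only [AddMonoidAlgebra.coeff_domCongr] at h3
  exact h3

/-! ### Exponents of patterns: triangularity and leading coefficient -/

theorem prod_xpow {n : ℕ} (e : Fin n → ℚ) :
    ∏ i, xpow i (e i) = AddMonoidAlgebra.single e (1 : ℂ) := by
  have h : ∀ s : Finset (Fin n), ∏ i ∈ s, xpow i (e i) =
      AddMonoidAlgebra.single (∑ i ∈ s, Pi.single i (e i)) (1 : ℂ) := by
    classical
    intro s
    induction s using Finset.induction_on with
    | empty => simp [AddMonoidAlgebra.one_def]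
    | insert i s hi ih =>
      rw [Finset.prod_insert hi, Finset.sum_insert hi, ih, xpow,
        AddMonoidAlgebra.single_mul_single, one_mul]
  rw [h, Finset.univ_sum_single]

theorem transCB_eq_sum_single {n : ℕ} (lam : Fin n → ℚ) (β : ℂ) :
    transCB lam β = ∑ z ∈ (splitPatterns_finite lam).toFinset,
      AddMonoidAlgebra.single (fun i : Fin n => patternExponent z i) (β ^ atypCount n z) := by
  rw [transCB_eq_patternSum, patternSum]
  refine Finset.sum_congr rfl fun z _ => ?_
  rw [prod_xpow (fun i : Fin n => patternExponent z i), AddMonoidAlgebra.smul_single, smul_eq_mul,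
    mul_one]

theorem coeff_transCB {n : ℕ} (lam : Fin n → ℚ) (β : ℂ) (v : Fin n → ℚ) :
    (transCB lam β).coeff v = ∑ z ∈ (splitPatterns_finite lam).toFinset,
      if (fun i : Fin n => patternExponent z i) = v then β ^ atypCount n z else 0 := by
  rw [transCB_eq_sum_single, AddMonoidAlgebra.coeff_sum, Finset.sum_apply']
  simp [Finsupp.single_apply]

section exponents
variable {n : ℕ} {z : ℕ → ℕ → ℚ}

theorem IsSplitOrthogonalPattern.nonneg (hz : IsSplitOrthogonalPattern n z) (i j : ℕ) :
    0 ≤ z i j := by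
  by_cases hij : InHalfTriangle n i j
  · by_cases ho : i + 1 = 2 * j
    · obtain ⟨m, hm⟩ := hz.odd_end i j hij ho
      rw [hm]; positivity
    · rcases hz.same_kind with h | h <;> obtain ⟨m, hm⟩ := h i j hij ho <;> rw [hm] <;> positivity
  · rw [hz.eq_zero_outside i j hij]

theorem IsSplitOrthogonalPattern.le_of_le (hz : IsSplitOrthogonalPattern n z) {i i' j : ℕ}
    (hij : InHalfTriangle n i j) (hi : i ≤ i') (hi' : i' ≤ 2 * n) : z i j ≤ z i' j := by
  induction i', hi using Nat.le_induction with
  | base => exact le_rfl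
  | succ k hk ih =>
    obtain ⟨h1, h2, h3, h4⟩ := hij
    exact (ih (by omega)).trans (hz.interlace_right k j ⟨by omega, by omega, h3, by omega⟩
      ⟨by omega, hi', h3, by omega⟩)

theorem IsSplitOrthogonalPattern.rowSum_even_le (hz : IsSplitOrthogonalPattern n z) {i : ℕ}
    (hi : i < n) : rowSum z (2 * i) ≤ rowSum z (2 * i + 1) := by
  rw [rowSum_even, rowSum_odd, Fin.sum_univ_castSucc]
  have h1 : ∑ j : Fin i, z (2 * i) (j + 1) ≤ ∑ j : Fin i, z (2 * i + 1) (j.castSucc + 1) :=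
    Finset.sum_le_sum fun j _ => by
      have := j.isLt
      exact hz.interlace_right _ _ ⟨by omega, by omega, by omega, by omega⟩
        ⟨by omega, by omega, by simp, by simp; omega⟩
  have h2 := hz.nonneg (2 * i + 1) ((Fin.last i : ℕ) + 1)
  linarith

/-- The exponents are second differences of row sums. Since even rows have at most the sum of the
next odd row, this form bounds the partial sums of the exponents by `rowSum z (2 * k)`, the source
of triangularity. -/
theorem sum_patternExponent (k : ℕ) :
    ∑ i ∈ Finset.range k, patternExponent z i =
      rowSum z (2 * k) - 2 * ∑ i ∈ Finset.range k, (rowSum z (2 * i + 1) - rowSum z (2 * i)) := by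
  induction k with
  | zero => simp [rowSum]
  | succ k ih =>
    rw [Finset.sum_range_succ, ih, Finset.sum_range_succ, patternExponent_eq]
    ring

theorem sum_patternExponent_le {lam : Fin n → ℚ} (hz : z ∈ splitPatterns lam) {k : ℕ}
    (hk : k ≤ n) : ∑ i ∈ Finset.range k, patternExponent z i ≤ rowSum z (2 * k) := by
  rw [sum_patternExponent]
  have : 0 ≤ ∑ i ∈ Finset.range k, (rowSum z (2 * i + 1) - rowSum z (2 * i)) :=
    Finset.sum_nonneg fun i hi =>
      sub_nonneg.2 (hz.1.rowSum_even_le (by rw [Finset.mem_range] at hi; omega))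
  linarith

theorem entry_even_le {lam : Fin n → ℚ} (hz : z ∈ splitPatterns lam) {k j : ℕ} (hk : k ≤ n)
    (hj : j < k) : z (2 * k) (j + 1) ≤ lam ⟨j, hj.trans_le hk⟩ := by
  rw [← hz.2 ⟨j, hj.trans_le hk⟩]
  exact hz.1.le_of_le ⟨by omega, by omega, by omega, by omega⟩ (by omega) le_rfl

theorem rowSum_even_le_sum {lam : Fin n → ℚ} (hz : z ∈ splitPatterns lam) {k : ℕ} (hk : k ≤ n) :
    rowSum z (2 * k) ≤ ∑ j : Fin k, lam ⟨j, j.isLt.trans_le hk⟩ := by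
  rw [rowSum_even]
  exact Finset.sum_le_sum fun j _ => entry_even_le hz hk j.isLt

end exponents

/-- The pattern with the leading exponent. -/
def leadingPattern {n : ℕ} (lam : Fin n → ℚ) (i j : ℕ) : ℚ :=
  if i ≤ 2 * n ∧ 2 * j ≤ i then rowOf lam j else 0

section leading
variable {n : ℕ} {lam : Fin n → ℚ}

theorem leadingPattern_eq {i : ℕ} {j : Fin n} (hi : i ≤ 2 * n) (hj : 2 * ((j : ℕ) + 1) ≤ i) :
    leadingPattern lam i (j + 1) = lam j := by
  rw [leadingPattern, if_pos ⟨hi, hj⟩, rowOf_succ]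

theorem leadingPattern_eq_zero {i j : ℕ} (h : i < 2 * j) : leadingPattern lam i j = 0 := by
  rw [leadingPattern, if_neg (by omega)]

theorem leadingPattern_mem (h : IsPartition lam) : leadingPattern lam ∈ splitPatterns lam := by
  have hnn : ∀ j, ∃ m : ℕ, rowOf lam j = m := fun j => by
    by_cases hj : 1 ≤ j ∧ j ≤ n
    · obtain ⟨k, rfl⟩ : ∃ k : Fin n, j = k + 1 := ⟨⟨j - 1, by omega⟩, by simp; omega⟩
      rw [rowOf_succ]; exact h.2 k
    · exact ⟨0, by simpa using rowOf_outside lam hj⟩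
  have hkind : ∀ i j, ∃ m : ℕ, leadingPattern lam i j = m := fun i j => by
    unfold leadingPattern
    split_ifs
    · exact hnn j
    · exact ⟨0, by simp⟩
  have h0 : ∀ i j, 0 ≤ leadingPattern lam i j := fun i j => by
    obtain ⟨m, hm⟩ := hkind i j
    rw [hm]; positivity
  refine ⟨⟨?_, ?_, Or.inl fun i j _ _ => hkind i j, ?_, ?_⟩, fun j => ?_⟩
  · intro i j hij
    unfold leadingPattern
    split_ifs with h1
    · exact rowOf_outside _ (by unfold InHalfTriangle at hij; omega)
    · rfl
  · intro i j _ ho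
    exact ⟨0, by rw [leadingPattern_eq_zero (by omega)]; simp⟩
  · rintro i j ⟨h1, h2, h3, h4⟩ ⟨h1', h2', h3', h4'⟩
    by_cases hj : 2 * (j + 1) ≤ i + 1
    · obtain ⟨k, rfl⟩ : ∃ k : ℕ, j = k + 1 := ⟨j - 1, by omega⟩
      have e1 := leadingPattern_eq (lam := lam) (i := i + 1) (j := ⟨k + 1, by omega⟩) h2' hj
      have e2 := leadingPattern_eq (lam := lam) (i := i) (j := ⟨k, by omega⟩) h2 (by simp; omega)
      simp only at e1 e2
      rw [e1, e2]
      exact h.1 (by simp)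
    · rw [leadingPattern_eq_zero (by omega)]
      exact h0 _ _
  · rintro i j ⟨h1, h2, h3, h4⟩ ⟨h1', h2', h3', h4'⟩
    by_cases hj : 2 * j ≤ i
    · rw [leadingPattern, leadingPattern, if_pos ⟨h2, hj⟩, if_pos ⟨h2', by omega⟩]
    · rw [leadingPattern_eq_zero (by omega)]
      exact h0 _ _
  · exact leadingPattern_eq le_rfl (by have := j.isLt; omega)

theorem rowSum_leadingPattern_odd {i : ℕ} (hi : i < n) :
    rowSum (leadingPattern lam) (2 * i + 1) = rowSum (leadingPattern lam) (2 * i) := by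
  rw [rowSum_even, rowSum_odd, Fin.sum_univ_castSucc, leadingPattern_eq_zero (by simp; omega),
    add_zero]
  refine Finset.sum_congr rfl fun j _ => ?_
  have hj := j.isLt
  have e := fun r => leadingPattern_eq (lam := lam) (i := r) (j := ⟨j, hj.trans hi⟩)
  simp only at e
  rw [Fin.val_castSucc, e _ (by omega) (by omega), e _ (by omega) (by omega)]

theorem patternExponent_leadingPattern (i : Fin n) :
    patternExponent (leadingPattern lam) i = lam i := by
  have hi := i.isLt
  rw [patternExponent_eq, rowSum_leadingPattern_odd hi, rowSum_even, rowSum_even,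
    Fin.sum_univ_castSucc, Fin.val_last, leadingPattern_eq (by omega) (by omega)]
  have : ∑ j : Fin i, leadingPattern lam (2 * (i + 1)) (j.castSucc + 1) =
      ∑ j : Fin i, leadingPattern lam (2 * i) (j + 1) := Finset.sum_congr rfl fun j _ => by
    have hj := j.isLt
    have e := fun r => leadingPattern_eq (lam := lam) (i := r) (j := ⟨j, hj.trans hi⟩)
    simp only at e
    rw [Fin.val_castSucc, e _ (by omega) (by omega), e _ (by omega) (by omega)]
  rw [this]
  ring

/-- Exponent `λ` forces equality throughout the chain of bounds: partial sum of exponents, sum of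
row `2k`, partial sum of `λ`. Hence each even row is an initial segment of `λ`, and each odd row
repeats the preceding row followed by `0`. -/
theorem eq_leadingPattern {z : ℕ → ℕ → ℚ} (hz : z ∈ splitPatterns lam)
    (h : ∀ i : Fin n, patternExponent z i = lam i) : z = leadingPattern lam := by
  have hsum : ∀ k (hk : k ≤ n), ∑ i ∈ Finset.range k, patternExponent z i =
      ∑ j : Fin k, lam ⟨j, j.isLt.trans_le hk⟩ := fun k hk => by
    rw [Finset.sum_range]
    exact Finset.sum_congr rfl fun j _ => h ⟨j, j.isLt.trans_le hk⟩
  have hrow : ∀ k (hk : k ≤ n), rowSum z (2 * k) = ∑ j : Fin k, lam ⟨j, j.isLt.trans_le hk⟩ :=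
    fun k hk => le_antisymm (rowSum_even_le_sum hz hk)
      ((hsum k hk).symm.le.trans (sum_patternExponent_le hz hk))
  have heven : ∀ k (hk : k ≤ n) (j : Fin k), z (2 * k) (j + 1) = lam ⟨j, j.isLt.trans_le hk⟩ := by
    intro k hk j
    have h1 := hrow k hk
    rw [rowSum_even] at h1
    exact (Finset.sum_eq_sum_iff_of_le fun (j : Fin k) _ => entry_even_le hz hk j.isLt).1 h1 j
      (Finset.mem_univ j)
  have hoddsum : ∀ i < n, rowSum z (2 * i + 1) = rowSum z (2 * i) := by
    intro i hi
    have h1 := patternExponent_eq z i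
    have h2 := h ⟨i, hi⟩
    have h3 := hrow (i + 1) hi
    rw [Fin.sum_univ_castSucc] at h3
    have h4 := hrow i hi.le
    simp only [Fin.val_castSucc, Fin.val_last] at h2 h3
    linarith
  have hodd : ∀ i < n, (∀ j : Fin i, z (2 * i) (j + 1) = z (2 * i + 1) (j + 1)) ∧
      z (2 * i + 1) (i + 1) = 0 := by
    intro i hi
    have h1 := hoddsum i hi
    rw [rowSum_even, rowSum_odd, Fin.sum_univ_castSucc] at h1
    simp only [Fin.val_castSucc, Fin.val_last] at h1
    have hle : ∀ j ∈ (Finset.univ : Finset (Fin i)), z (2 * i) (j + 1) ≤ z (2 * i + 1) (j + 1) :=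
      fun j _ => by
        have := j.isLt
        exact hz.1.interlace_right _ _ ⟨by omega, by omega, by omega, by omega⟩
          ⟨by omega, by omega, by omega, by omega⟩
    have h2 := hz.1.nonneg (2 * i + 1) (i + 1)
    have h3 := Finset.sum_le_sum hle
    have h4 : z (2 * i + 1) (i + 1) = 0 := by linarith
    refine ⟨fun j => ?_, h4⟩
    exact (Finset.sum_eq_sum_iff_of_le hle).1 (by linarith) j (Finset.mem_univ j)
  funext i j
  by_cases hij : InHalfTriangle n i j
  · obtain ⟨h1, h2, h3, h4⟩ := hij
    obtain ⟨m, rfl⟩ : ∃ m, j = m + 1 := ⟨j - 1, by omega⟩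
    have e := fun r (hm : m < n) h1 h2 => leadingPattern_eq (lam := lam) (i := r) (j := ⟨m, hm⟩) h1 h2
    simp only at e
    rcases Nat.even_or_odd' i with ⟨k, rfl | rfl⟩
    · rw [e _ (by omega) h2 (by omega)]
      exact heven k (by omega) ⟨m, by omega⟩
    · by_cases hm : m = k
      · subst hm
        rw [leadingPattern_eq_zero (by omega)]
        exact (hodd m (by omega)).2
      · rw [e _ (by omega) h2 (by omega), ← (hodd k (by omega)).1 ⟨m, by omega⟩]
        exact heven k (by omega) ⟨m, by omega⟩
  · rw [hz.1.eq_zero_outside i j hij]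
    unfold leadingPattern
    split_ifs with h1
    · exact (rowOf_outside _ (by unfold InHalfTriangle at hij; omega)).symm
    · rfl

theorem atypCount_leadingPattern (h : IsPartition lam) : atypCount n (leadingPattern lam) = 0 := by
  classical
  rw [atypCount, Finset.card_eq_zero, Finset.filter_eq_empty_iff]
  intro i hi
  rw [Finset.mem_Icc] at hi
  have hn : 0 < n := by omega
  obtain ⟨m, hm⟩ := h.2 ⟨0, hn⟩
  have hk : leadingPattern lam (2 * n) 1 = (m : ℤ) + (0 : ℕ) / 2 := by
    have := (leadingPattern_mem h).2 ⟨0, hn⟩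
    simp only [zero_add] at this
    rw [this, hm]; simp
  rw [isAtypical_iff zero_le_one hk, leadingPattern_eq_zero (by omega)]
  rintro ⟨l, hl⟩
  exact int_ne_int_add_half l 0 (by push_cast at hl ⊢; linarith)

theorem coeff_transCB_self (h : IsPartition lam) (β : ℂ) : (transCB lam β).coeff lam = 1 := by
  rw [coeff_transCB, Finset.sum_eq_single (leadingPattern lam)]
  · rw [if_pos (funext patternExponent_leadingPattern), atypCount_leadingPattern h, pow_zero]
  · intro z hz hne
    rw [if_neg]
    intro he
    exact hne (eq_leadingPattern (by simpa using hz) (congrFun he))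
  · intro hn
    exact absurd (by simpa using leadingPattern_mem h) hn

theorem coeff_transCB_eq_zero {v : Fin n → ℚ} {k : Fin n} (β : ℂ)
    (hk : ∑ i ∈ Finset.Iic k, lam i < ∑ i ∈ Finset.Iic k, v i) : (transCB lam β).coeff v = 0 := by
  rw [coeff_transCB]
  refine Finset.sum_eq_zero fun z hz => if_neg ?_
  rintro rfl
  rw [Set.Finite.mem_toFinset] at hz
  have hk' : (k : ℕ) + 1 ≤ n := k.isLt
  have hsum : ∀ g : Fin n → ℚ, ∑ i ∈ Finset.Iic k, g i =
      ∑ j : Fin (k + 1), g ⟨j, j.isLt.trans_le hk'⟩ := fun g => by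
    symm
    refine Finset.sum_bij (fun j _ => ⟨j, j.isLt.trans_le hk'⟩) ?_ ?_ ?_ ?_
    · intro j _
      rw [Finset.mem_Iic, Fin.le_def]
      have := j.isLt
      simp only; omega
    · intro i _ j _ hij
      exact Fin.ext (by simpa using hij)
    · intro i hi
      rw [Finset.mem_Iic, Fin.le_def] at hi
      exact ⟨⟨i, by omega⟩, Finset.mem_univ _, rfl⟩
    · intro _ _; rfl
  rw [hsum, hsum] at hk
  have h1 := (sum_patternExponent_le hz hk').trans (rowSum_even_le_sum hz hk')
  rw [Finset.sum_range] at h1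
  exact absurd hk h1.not_gt

end leading

/-! ### Integrality of the exponents and descent to ordinary Laurent polynomials. -/

theorem patternExponent_int {n : ℕ} {lam : Fin n → ℚ} (h : IsPartition lam) {z : ℕ → ℕ → ℚ}
    (hz : z ∈ splitPatterns lam) (i : Fin n) : ∃ m : ℤ, patternExponent z i = m := by
  have hi := i.isLt
  have hn : 0 < n := by omega
  obtain ⟨m₀, hm₀⟩ := h.2 ⟨0, hn⟩
  have hk : z (2 * n) 1 = (m₀ : ℤ) + (0 : ℕ) / 2 := by
    have := hz.2 ⟨0, hn⟩
    simp only [zero_add] at this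
    rw [this, hm₀]; simp
  have hint : ∀ k ≤ n, ∃ m : ℤ, rowSum z (2 * k) = m := by
    intro k hkn
    have : ∀ j : Fin k, ∃ m : ℤ, z (2 * k) (j + 1) = m := fun j => by
      have := j.isLt
      obtain ⟨m, hm⟩ := hz.1.same_kind' zero_le_one hk (i := 2 * k) (j := j + 1)
        ⟨by omega, by omega, by omega, by omega⟩ (by omega)
      exact ⟨m, by simpa using hm⟩
    choose m hm using this
    exact ⟨∑ j, m j, by rw [rowSum_even]; push_cast; exact Finset.sum_congr rfl fun j _ => hm j⟩
  -- An odd end may be half-integral, but odd rows enter the exponent with factor `2`.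
  have hhalf : ∀ j : Fin (i + 1), ∃ m : ℤ, 2 * z (2 * i + 1) (j + 1) = m := fun j => by
    have hj := j.isLt
    have hin : InHalfTriangle n (2 * i + 1) (j + 1) := ⟨by omega, by omega, by omega, by omega⟩
    by_cases ho : 2 * (i : ℕ) + 1 + 1 = 2 * ((j : ℕ) + 1)
    · obtain ⟨m, hm⟩ := hz.1.odd_end _ _ hin ho
      exact ⟨m, by rw [hm]; push_cast; ring⟩
    · obtain ⟨m, hm⟩ := hz.1.same_kind' zero_le_one hk hin ho
      exact ⟨2 * m, by rw [hm]; simp⟩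
  choose m hm using hhalf
  obtain ⟨p, hp⟩ := hint (i + 1) hi
  obtain ⟨q, hq⟩ := hint i hi.le
  refine ⟨p - ∑ j, m j + q, ?_⟩
  rw [patternExponent_eq, hp, hq, rowSum_odd, Finset.mul_sum, Finset.sum_congr rfl fun j _ => hm j]
  push_cast
  ring

/-- Integer exponents as rational exponents. -/
def ratExponent {n : ℕ} (a : Fin n → ℤ) : Fin n → ℚ := fun i => (a i : ℚ)

theorem ratExponent_injective {n : ℕ} : Function.Injective (ratExponent (n := n)) := by
  intro a b h
  funext i
  have := congrFun h i
  simpa [ratExponent] using this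

theorem coeff_toFracLaurent {n : ℕ} (f : Laurent n) (a : Fin n → ℤ) :
    f.toFracLaurent.coeff (ratExponent a) = f.coeff a :=
  Finsupp.mapDomain_apply ratExponent_injective f.coeff a

/-- The interpolating polynomial of a partition as a Laurent polynomial. -/
def transLaurent {n : ℕ} (lam : Fin n → ℚ) (β : ℂ) : Laurent n :=
  ∑ z ∈ (splitPatterns_finite lam).toFinset,
    AddMonoidAlgebra.single (fun i : Fin n => ⌊patternExponent z i⌋) (β ^ atypCount n z)

theorem ratExponent_floor {n : ℕ} {lam : Fin n → ℚ} (h : IsPartition lam) {z : ℕ → ℕ → ℚ}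
    (hz : z ∈ splitPatterns lam) :
    ratExponent (fun i : Fin n => ⌊patternExponent z i⌋) = fun i : Fin n => patternExponent z i := by
  funext i
  obtain ⟨m, hm⟩ := patternExponent_int h hz i
  simp [ratExponent, hm]

theorem toFracLaurent_transLaurent {n : ℕ} {lam : Fin n → ℚ} (h : IsPartition lam) (β : ℂ) :
    (transLaurent lam β).toFracLaurent = transCB lam β := by
  have hsum : ∀ (s : Finset (ℕ → ℕ → ℚ)) (f : (ℕ → ℕ → ℚ) → Laurent n),
      (∑ z ∈ s, f z).toFracLaurent = ∑ z ∈ s, (f z).toFracLaurent := fun s f =>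
    map_sum (⟨⟨Laurent.toFracLaurent, AddMonoidAlgebra.mapDomain_zero _⟩,
      AddMonoidAlgebra.mapDomain_add _⟩ : Laurent n →+ FracLaurent n) f s
  rw [transCB_eq_sum_single, transLaurent, hsum]
  refine Finset.sum_congr rfl fun z hz => ?_
  rw [Set.Finite.mem_toFinset] at hz
  rw [Laurent.toFracLaurent, AddMonoidAlgebra.mapDomain_single]
  congr 1
  exact ratExponent_floor h hz

theorem coeff_transLaurent {n : ℕ} {lam : Fin n → ℚ} (h : IsPartition lam) (β : ℂ)
    (a : Fin n → ℤ) : (transLaurent lam β).coeff a = (transCB lam β).coeff (ratExponent a) := by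
  rw [← toFracLaurent_transLaurent h, coeff_toFracLaurent]

theorem isBCInvariant_transLaurent {n : ℕ} {lam : Fin n → ℚ} (h : IsPartition lam) (β : ℂ) :
    IsBCInvariant (transLaurent lam β) := by
  obtain ⟨a, ha, ha0, rfl⟩ := h.exists_halfShift
  refine ⟨fun σ v => ?_, fun i v => ?_⟩
  · rw [coeff_transLaurent h, coeff_transLaurent h]
    exact coeff_transCB_comp_perm β ha ha0 σ (ratExponent v)
  · rw [coeff_transLaurent h, coeff_transLaurent h, ← coeff_transCB_update_neg β ha ha0 i]
    congr 1
    funext j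
    by_cases hj : j = i
    · subst hj; simp [ratExponent]
    · simp [ratExponent, hj]

/-! ### Orthogonality on the circle -/

/-- The function `w ^ k - w ^ (-k) + β (w ^ (k - 1) - w ^ (1 - k))` of a complex variable. -/
def circleFun (β : ℂ) (k : ℤ) (w : ℂ) : ℂ :=
  w ^ k - w ^ (-k) + β * (w ^ (k - 1) - w ^ (-(k - 1)))

theorem one_add_mul_ne_zero {β w : ℂ} (hβ : ‖β‖ < 1) (hw : ‖w‖ ≤ 1) : 1 + β * w ≠ 0 := by
  intro h
  have h1 : β * w = -1 := by linear_combination h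
  have h2 : ‖β * w‖ = 1 := by rw [h1]; simp
  rw [norm_mul] at h2
  nlinarith [norm_nonneg β, norm_nonneg w]

/-- In the angle, `dw/w` is a constant multiple of `dθ` and inversion is the reflection `θ ↦ 2π -
θ`. -/
theorem circleIntegral_comp_inv (φ : ℂ → ℂ) :
    (∮ w in C(0, 1), φ w⁻¹ * w⁻¹) = ∮ w in C(0, 1), φ w * w⁻¹ := by
  have h : ∀ ψ : ℂ → ℂ, (∮ w in C(0, 1), ψ w * w⁻¹) =
      ∫ θ : ℝ in (0)..2 * Real.pi, Complex.I * ψ (Complex.exp (θ * Complex.I)) := fun ψ => by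
    rw [circleIntegral]
    refine intervalIntegral.integral_congr fun θ _ => ?_
    have := Complex.exp_ne_zero (θ * Complex.I)
    simp only [deriv_circleMap, circleMap, zero_add, Complex.ofReal_one, one_mul, smul_eq_mul]
    field_simp
  rw [h φ, h (fun w => φ w⁻¹)]
  have h2 := intervalIntegral.integral_comp_sub_left (a := 0) (b := 2 * Real.pi)
    (fun θ : ℝ => Complex.I * φ (Complex.exp (θ * Complex.I))) (2 * Real.pi)
  rw [sub_self, sub_zero] at h2
  rw [← h2]
  refine intervalIntegral.integral_congr fun θ _ => ?_
  congr 2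
  rw [← Complex.exp_neg, Complex.ofReal_sub, sub_mul, Complex.exp_sub]
  push_cast
  rw [Complex.exp_two_pi_mul_I, Complex.exp_neg, one_div]

theorem circleIntegral_zpow_mul_inv (k : ℤ) :
    (∮ w in C(0, 1), w ^ k * w⁻¹) = if k = 0 then 2 * Real.pi * Complex.I else 0 := by
  split_ifs with h
  · subst h
    have := circleIntegral.integral_sub_center_inv (0 : ℂ) (R := 1) one_ne_zero
    simpa using this
  · have := circleIntegral.integral_sub_zpow_of_ne (n := k - 1) (by omega) (0 : ℂ) 0 1
    refine Eq.trans ?_ this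
    refine circleIntegral.integral_congr zero_le_one fun w hw => ?_
    have hw0 : w ≠ 0 := by
      rintro rfl; simp at hw
    simp only [sub_zero]
    rw [zpow_sub_one₀ hw0]

/-- As `circleFun β l w = w^l (1 + βw⁻¹) - w^(-l) (1 + βw)`, the quotient expands to `w^(l-m) +
w^(m-l) - A w - A w⁻¹`. The first two terms give the right-hand side; the last two integrate to zero
because `A w / w` extends holomorphically to the disc, its only pole lying outside when `‖β‖ < 1`.
-/
theorem circleIntegral_circleFun_mul {β : ℂ} (hβ : ‖β‖ < 1) {l m : ℤ} (hl : 1 ≤ l) (hm : 1 ≤ m) :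
    (∮ w in C(0, 1), circleFun β l w * circleFun β m w⁻¹ / ((1 + β * w) * (1 + β * w⁻¹)) * w⁻¹) =
      if l = m then 2 * (2 * Real.pi * Complex.I) else 0 := by
  let A : ℂ → ℂ := fun w => w ^ (l + m) * (1 + β * w⁻¹) / (1 + β * w)
  have hw0 : ∀ w ∈ Metric.sphere (0 : ℂ) 1, w ≠ 0 := by
    rintro w hw rfl; simp at hw
  have hw1 : ∀ w ∈ Metric.sphere (0 : ℂ) 1, 1 + β * w ≠ 0 := fun w hw =>
    one_add_mul_ne_zero hβ (by simpa using hw.le)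
  have hw2 : ∀ w ∈ Metric.sphere (0 : ℂ) 1, 1 + β * w⁻¹ ≠ 0 := fun w hw =>
    one_add_mul_ne_zero hβ (by
      have : ‖w‖ = 1 := by simpa using hw
      simp [this])
  have hcz : ∀ k : ℤ, CircleIntegrable (fun w => w ^ k * w⁻¹) 0 1 := fun k =>
    ContinuousOn.circleIntegrable zero_le_one
      ((continuousOn_id.zpow₀ k fun w hw => Or.inl (hw0 w hw)).mul (continuousOn_id.inv₀ hw0))
  have hcA : CircleIntegrable (fun w => A w * w⁻¹) 0 1 := by
    refine ContinuousOn.circleIntegrable zero_le_one (ContinuousOn.mul ?_ (continuousOn_id.inv₀ hw0))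
    refine ContinuousOn.div (ContinuousOn.mul (continuousOn_id.zpow₀ _ fun w hw =>
      Or.inl (hw0 w hw)) ?_) ?_ hw1
    · exact continuousOn_const.add (continuousOn_const.mul (continuousOn_id.inv₀ hw0))
    · exact continuousOn_const.add (continuousOn_const.mul continuousOn_id)
  have hcA' : CircleIntegrable (fun w => A w⁻¹ * w⁻¹) 0 1 := by
    refine ContinuousOn.circleIntegrable zero_le_one (ContinuousOn.mul ?_ (continuousOn_id.inv₀ hw0))
    have hi : ContinuousOn (fun w : ℂ => w⁻¹) (Metric.sphere 0 1) := continuousOn_id.inv₀ hw0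
    refine ContinuousOn.div (ContinuousOn.mul (hi.zpow₀ _ fun w hw =>
      Or.inl (inv_ne_zero (hw0 w hw))) ?_) ?_ hw2
    · simp only [inv_inv]
      exact continuousOn_const.add (continuousOn_const.mul continuousOn_id)
    · exact continuousOn_const.add (continuousOn_const.mul hi)
  have hA0 : (∮ w in C(0, 1), A w * w⁻¹) = 0 := by
    -- Since `l + m ≥ 2`, the negative powers cancel and `A w / w` equals `w^p (w + β) / (1 + βw)`.
    obtain ⟨p, hp⟩ : ∃ p : ℕ, l + m = p + 2 := ⟨(l + m - 2).toNat, by omega⟩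
    have hcongr : (∮ w in C(0, 1), A w * w⁻¹) =
        ∮ w in C(0, 1), w ^ p * (w + β) / (1 + β * w) := by
      refine circleIntegral.integral_congr zero_le_one fun w hw => ?_
      have h0 := hw0 w hw
      have h1 := hw1 w hw
      simp only [A, hp]
      rw [show ((p : ℤ) + 2) = ((p + 2 : ℕ) : ℤ) by push_cast; ring, zpow_natCast]
      field_simp
      ring
    rw [hcongr]
    have hne : ∀ w ∈ Metric.closedBall (0 : ℂ) 1, 1 + β * w ≠ 0 := fun w hw =>
      one_add_mul_ne_zero hβ (by simpa using hw)
    refine Complex.circleIntegral_eq_zero_of_differentiable_on_off_countable zero_le_one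
      Set.countable_empty ?_ ?_
    · exact ContinuousOn.div (by fun_prop) (by fun_prop) hne
    · intro w hw
      refine DifferentiableAt.div (by fun_prop) (by fun_prop) (hne w ?_)
      exact Metric.ball_subset_closedBall hw.1
  have hcongr : (∮ w in C(0, 1),
        circleFun β l w * circleFun β m w⁻¹ / ((1 + β * w) * (1 + β * w⁻¹)) * w⁻¹) =
      ∮ w in C(0, 1), ((w ^ (l - m) * w⁻¹ + w ^ (m - l) * w⁻¹) - (A w * w⁻¹ + A w⁻¹ * w⁻¹)) := by
    refine circleIntegral.integral_congr zero_le_one fun w hw => ?_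
    have h0 := hw0 w hw
    have h1 := hw1 w hw
    have h2 := hw2 w hw
    have h2' : w + β ≠ 0 := by
      intro h
      apply h2
      have : 1 + β * w⁻¹ = (w + β) * w⁻¹ := by field_simp
      rw [this, h, zero_mul]
    simp only [A, circleFun, inv_zpow', neg_sub, inv_inv, neg_neg, neg_add]
    rw [zpow_sub₀ h0, zpow_sub₀ h0, zpow_add₀ h0, zpow_add₀ h0, zpow_neg, zpow_neg, zpow_sub₀ h0,
      zpow_sub₀ h0, zpow_sub₀ h0, zpow_sub₀ h0, zpow_one]
    have hl0 : w ^ l ≠ 0 := zpow_ne_zero _ h0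
    have hm0 : w ^ m ≠ 0 := zpow_ne_zero _ h0
    generalize w ^ l = L at *
    generalize w ^ m = M at *
    field_simp
    ring
  have e := circleIntegral.integral_sub ((hcz (l - m)).add (hcz (m - l))) (hcA.add hcA')
  simp only [Pi.add_apply] at e
  rw [hcongr, e, circleIntegral.integral_add (hcz _) (hcz _),
    circleIntegral.integral_add hcA hcA', circleIntegral_comp_inv, hA0, circleIntegral_zpow_mul_inv, circleIntegral_zpow_mul_inv]
  by_cases h : l = m
  · subst h; simp; ring
  · rw [if_neg (by omega), if_neg (by omega), if_neg h]; simp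

/-! ### Integrals over the torus -/

/-- Fubini: the angular box and the Jacobian of the torus are products over the coordinates. -/
theorem torusIntegral_prod {n : ℕ} (g : Fin n → ℂ → ℂ) :
    torusIntegral (fun z : Fin n → ℂ => ∏ i, g i (z i)) 0 1 = ∏ i, ∮ w in C(0, 1), g i w := by
  have h1 : ∀ i, (∮ w in C(0, 1), g i w) = ∫ θ : ℝ in Set.Icc 0 (2 * Real.pi),
      (Complex.exp (θ * Complex.I) * Complex.I) * g i (Complex.exp (θ * Complex.I)) := fun i => by
    rw [circleIntegral_def_Icc]
    simp [circleMap]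
  have h2 : (Set.Icc (0 : Fin n → ℝ) fun _ => 2 * Real.pi) =
      Set.univ.pi fun _ => Set.Icc 0 (2 * Real.pi) := by
    rw [← Set.pi_univ_Icc]; rfl
  simp only [h1]
  rw [torusIntegral, h2, MeasureTheory.volume_pi, MeasureTheory.Measure.restrict_pi_pi,
    ← MeasureTheory.integral_fintype_prod_eq_prod]
  refine MeasureTheory.integral_congr_ae (Filter.Eventually.of_forall fun θ => ?_)
  simp [torusMap, Finset.prod_mul_distrib]

theorem torusIntegral_finset_sum {n : ℕ} {ι : Type*} (s : Finset ι)
    (f : ι → (Fin n → ℂ) → ℂ) (hf : ∀ i ∈ s, TorusIntegrable (f i) 0 1) :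
    torusIntegral (fun z => ∑ i ∈ s, f i z) 0 1 = ∑ i ∈ s, torusIntegral (f i) 0 1 := by
  simp only [torusIntegral, Finset.smul_sum]
  exact MeasureTheory.integral_finsetSum s fun i hi => (hf i hi).function_integrable

theorem torusIntegrable_of_continuousOn {n : ℕ} {f : (Fin n → ℂ) → ℂ}
    (hf : ContinuousOn f {z | ∀ i, ‖z i‖ = 1}) : TorusIntegrable f 0 1 := by
  have h : Continuous fun θ : Fin n → ℝ => f (torusMap 0 1 θ) := by
    refine hf.comp_continuous ?_ fun θ i => ?_
    · unfold torusMap; fun_prop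
    · simp [torusMap, Complex.norm_exp_ofReal_mul_I]
  exact h.continuousOn.integrableOn_compact isCompact_Icc

theorem torusIntegral_congr {n : ℕ} {f g : (Fin n → ℂ) → ℂ}
    (h : ∀ z : Fin n → ℂ, (∀ i, ‖z i‖ = 1) → f z = g z) :
    torusIntegral f 0 1 = torusIntegral g 0 1 := by
  unfold torusIntegral
  congr 1
  funext θ
  rw [h]
  intro i
  simp [torusMap, Complex.norm_exp_ofReal_mul_I]

/-! ### Evaluation -/

theorem Laurent.eval_add {n : ℕ} (f g : Laurent n) (z : Fin n → ℂ) :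
    (f + g).eval z = f.eval z + g.eval z :=
  Finsupp.sum_add_index' (by simp) fun _ _ _ => add_mul _ _ _

theorem Laurent.eval_smul {n : ℕ} (c : ℂ) (f : Laurent n) (z : Fin n → ℂ) :
    (c • f).eval z = c * f.eval z := by
  rw [Laurent.eval, AddMonoidAlgebra.coeff_smul, Finsupp.sum_smul_index (by simp), Laurent.eval,
    Finsupp.mul_sum]
  simp only [mul_assoc]

theorem Laurent.eval_single {n : ℕ} (a : Fin n → ℤ) (c : ℂ) (z : Fin n → ℂ) :
    Laurent.eval (AddMonoidAlgebra.single a c) z = c * ∏ i, z i ^ a i := by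
  rw [Laurent.eval, AddMonoidAlgebra.coeff_single, Finsupp.sum_single_index (by simp)]

theorem Laurent.eval_sum {n : ℕ} {ι : Type*} (s : Finset ι) (f : ι → Laurent n) (z : Fin n → ℂ) :
    (∑ i ∈ s, f i).eval z = ∑ i ∈ s, (f i).eval z :=
  map_sum (⟨⟨fun f => Laurent.eval f z, by simp [Laurent.eval]⟩,
    fun f g => Laurent.eval_add f g z⟩ : Laurent n →+ ℂ) f s

theorem Laurent.continuousOn_eval {n : ℕ} (f : Laurent n) :
    ContinuousOn f.eval {z | ∀ i, ‖z i‖ = 1} := by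
  unfold Laurent.eval Finsupp.sum
  refine continuousOn_finsetSum _ fun a _ => continuousOn_const.mul ?_
  refine continuousOn_finsetProd _ fun i _ => ?_
  refine (continuous_apply i).continuousOn.zpow₀ _ fun z hz => Or.inl ?_
  intro h
  have := hz i
  rw [h] at this
  simp at this

/-- Complex powers with rational exponents. -/
def expPow (w : ℂ) (q : ℚ) : ℂ := Complex.exp (q * Complex.log w)

theorem isPow_expPow (w : ℂ) : IsPow (expPow w) := by
  refine ⟨by simp [expPow], fun p q => ?_⟩
  rw [expPow, expPow, expPow, ← Complex.exp_add]
  push_cast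
  rw [add_mul]

theorem expPow_intCast {w : ℂ} (hw : w ≠ 0) (k : ℤ) : expPow w k = w ^ k := by
  rw [expPow, Rat.cast_intCast, Complex.exp_int_mul, Complex.exp_log hw]

theorem expPow_one {w : ℂ} (hw : w ≠ 0) : expPow w 1 = w := by
  simpa using expPow_intCast hw 1

theorem expPow_neg_one {w : ℂ} (hw : w ≠ 0) : expPow w (-1) = w⁻¹ := by
  simpa using expPow_intCast hw (-1)

theorem alternantFun_expPow (β : ℂ) {w : ℂ} (hw : w ≠ 0) (k : ℤ) :
    alternantFun 0 β (expPow w) k = circleFun β k w := by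
  have h1 := expPow_intCast hw (-k)
  have h2 := expPow_intCast hw (k - 1)
  have h3 := expPow_intCast hw (-(k - 1))
  push_cast at h1 h2 h3
  rw [alternantFun, if_pos rfl, h1, h2, h3, expPow_intCast hw, smul_eq_mul, circleFun]

theorem eval_transLaurent {n : ℕ} {lam : Fin n → ℚ} (h : IsPartition lam) (β : ℂ) {z : Fin n → ℂ}
    (hz : ∀ i, z i ≠ 0) :
    (transLaurent lam β).eval z = patternSum lam β fun j => expPow (z j) := by
  rw [transLaurent, Laurent.eval_sum, patternSum]
  refine Finset.sum_congr rfl fun p hp => ?_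
  rw [Set.Finite.mem_toFinset] at hp
  rw [Laurent.eval_single, smul_eq_mul]
  congr 1
  refine Finset.prod_congr rfl fun i _ => ?_
  rw [← expPow_intCast (hz i)]
  exact congrArg (expPow (z i)) (congrFun (ratExponent_floor h hp) i)

/-- The bialternant formula over `ℂ`, kept in multiplied form because the Weyl denominator has zeros
on the torus when `n > 0`. The bound on `β` makes `1 + βz_i` regular. -/
theorem eval_transLaurent_mul_weylDenom {n : ℕ} {a : Fin n → ℤ} (ha : Antitone a)
    (ha0 : ∀ i, 0 ≤ a i) (hp : IsPartition (halfShift 0 a)) {β : ℂ} (hβ : ‖β‖ < 1) {z : Fin n → ℂ}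
    (hz : ∀ i, ‖z i‖ = 1) :
    (transLaurent (halfShift 0 a) β).eval z * weylDenom (fun j => expPow (z j)) =
      (Matrix.of fun i j : Fin n => circleFun β (a i + n - i) (z j)).det := by
  have hz0 : ∀ i, z i ≠ 0 := fun i h => by simpa [h] using hz i
  rw [eval_transLaurent hp β hz0,
    patternSum_mul_weylDenom zero_le_one β ha ha0 (fun i => isPow_expPow _)
      (fun i r s h => mul_left_cancel₀ (by
        rw [expPow_one (hz0 i), smul_eq_mul]
        exact one_add_mul_ne_zero hβ (hz i).le) h), alternant]
  simp only [alternantFun_expPow β (hz0 _)]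

/-! ### The density -/

theorem qPoch_zero (w : ℂ) : qPoch w 0 = 1 - w := by
  -- With `0 ^ 0 = 1`, only the factor `k = 0` differs from `1`.
  rw [qPoch, tprod_eq_mulSingle 0]
  · simp
  · intro k hk; simp [hk]

theorem koornwinderDensity_eq {n : ℕ} (β : ℂ) (z : Fin n → ℂ) :
    koornwinderDensity 0 0 ![-β, 0, 0, 0] z =
      (∏ i, (1 - z i ^ 2) * (1 - (z i)⁻¹ ^ 2) / ((1 + β * z i) * (1 + β * (z i)⁻¹))) *
        ∏ i, ∏ j ∈ Finset.Ioi i, (1 - z i * z j) * (1 - z i * (z j)⁻¹) *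
          ((1 - (z i)⁻¹ * z j) * (1 - (z i)⁻¹ * (z j)⁻¹)) := by
  have h2 : ∀ w : ℂ, w ^ (-2 : ℤ) = w⁻¹ ^ 2 := fun w => by
    rw [zpow_neg, inv_pow]; norm_cast
  have h3 : ∀ w : ℂ, w ^ (2 : ℤ) = w ^ 2 := fun w => by norm_cast
  unfold koornwinderDensity
  simp only [qPoch_zero, Finset.prod_pair (show (1 : ℤ) ≠ -1 by norm_num), Fin.prod_univ_four]
  simp [h2, h3, mul_div_mul_comm]

/-- For each pair `i < j` the four factors multiply to the square of `z_i + z_i⁻¹ - z_j - z_j⁻¹`,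
which is invariant under inversion, so one copy goes to each Weyl denominator; likewise `(1 - z²)(1
- z⁻²) = (z - z⁻¹)(z⁻¹ - z)`. -/
theorem koornwinderDensity_eq_weylDenom {n : ℕ} (β : ℂ) {z : Fin n → ℂ} (hz : ∀ i, z i ≠ 0) :
    koornwinderDensity 0 0 ![-β, 0, 0, 0] z =
      weylDenom (fun j => expPow (z j)) * weylDenom (fun j => expPow (z j)⁻¹) *
        ∏ i, ((1 + β * z i) * (1 + β * (z i)⁻¹))⁻¹ := by
  rw [koornwinderDensity_eq, weylDenom_eq_prod fun i => isPow_expPow _,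
    weylDenom_eq_prod fun i => isPow_expPow _]
  simp only [expPow_one (hz _), expPow_neg_one (hz _), expPow_one (inv_ne_zero (hz _)),
    expPow_neg_one (inv_ne_zero (hz _)), inv_inv]
  have h1 : ∏ i, (1 - z i ^ 2) * (1 - (z i)⁻¹ ^ 2) / ((1 + β * z i) * (1 + β * (z i)⁻¹)) =
      (∏ i, (z i - (z i)⁻¹)) * (∏ i, ((z i)⁻¹ - z i)) *
        ∏ i, ((1 + β * z i) * (1 + β * (z i)⁻¹))⁻¹ := by
    rw [← Finset.prod_mul_distrib, ← Finset.prod_mul_distrib]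
    refine Finset.prod_congr rfl fun i _ => ?_
    rw [div_eq_mul_inv]
    congr 1
    have := hz i
    field_simp
  have h2 : ∏ i, ∏ j ∈ Finset.Ioi i, (1 - z i * z j) * (1 - z i * (z j)⁻¹) *
          ((1 - (z i)⁻¹ * z j) * (1 - (z i)⁻¹ * (z j)⁻¹)) =
      (∏ i, ∏ j ∈ Finset.Ioi i, (z i + (z i)⁻¹ - z j - (z j)⁻¹)) *
        ∏ i, ∏ j ∈ Finset.Ioi i, ((z i)⁻¹ + z i - (z j)⁻¹ - z j) := by
    rw [← Finset.prod_mul_distrib]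
    refine Finset.prod_congr rfl fun i _ => ?_
    rw [← Finset.prod_mul_distrib]
    refine Finset.prod_congr rfl fun j _ => ?_
    have := hz i
    have := hz j
    field_simp
    ring
  rw [h1, h2]
  ring

/-- The integrand of the form. -/
def formIntegrand {n : ℕ} (β : ℂ) (f g : Laurent n) (z : Fin n → ℂ) : ℂ :=
  f.eval z * g.eval (fun i => (z i)⁻¹) * koornwinderDensity 0 0 ![-β, 0, 0, 0] z * ∏ i, (z i)⁻¹

theorem continuousOn_inv_coord {n : ℕ} (i : Fin n) :
    ContinuousOn (fun z : Fin n → ℂ => (z i)⁻¹) {z | ∀ i, ‖z i‖ = 1} := by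
  refine (continuous_apply i).continuousOn.inv₀ fun z hz h => ?_
  have := hz i
  rw [h] at this
  simp at this

theorem torusIntegrable_formIntegrand {n : ℕ} {β : ℂ} (hβ : ‖β‖ < 1) (f g : Laurent n) :
    TorusIntegrable (formIntegrand β f g) 0 1 := by
  refine torusIntegrable_of_continuousOn ?_
  have hi := continuousOn_inv_coord (n := n)
  have hc : ∀ i : Fin n, ContinuousOn (fun z : Fin n → ℂ => z i) {z | ∀ i, ‖z i‖ = 1} :=
    fun i => (continuous_apply i).continuousOn
  have hd : ContinuousOn (koornwinderDensity 0 0 ![-β, 0, 0, 0]) {z : Fin n → ℂ | ∀ i, ‖z i‖ = 1} := by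
    rw [funext (koornwinderDensity_eq β)]
    refine ContinuousOn.mul (continuousOn_finsetProd _ fun i _ => ContinuousOn.div ?_ ?_ ?_)
      (continuousOn_finsetProd _ fun i _ => continuousOn_finsetProd _ fun j _ => ?_)
    · exact (continuousOn_const.sub ((hc i).pow 2)).mul (continuousOn_const.sub ((hi i).pow 2))
    · exact (continuousOn_const.add (continuousOn_const.mul (hc i))).mul
        (continuousOn_const.add (continuousOn_const.mul (hi i)))
    · intro z hz
      exact mul_ne_zero (one_add_mul_ne_zero hβ (hz i).le)
        (one_add_mul_ne_zero hβ (by simp [hz i]))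
    · exact ((continuousOn_const.sub ((hc i).mul (hc j))).mul
        (continuousOn_const.sub ((hc i).mul (hi j)))).mul
        ((continuousOn_const.sub ((hi i).mul (hc j))).mul
        (continuousOn_const.sub ((hi i).mul (hi j))))
  refine ((f.continuousOn_eval.mul (g.continuousOn_eval.comp (continuousOn_pi.2 hi) ?_)).mul
    hd).mul (continuousOn_finsetProd _ fun i _ => hi i)
  intro z hz i
  change ‖(z i)⁻¹‖ = 1
  rw [norm_inv, hz i, inv_one]

theorem koornwinderForm_eq {n : ℕ} (β : ℂ) (f g : Laurent n) :
    koornwinderForm 0 0 ![-β, 0, 0, 0] f g =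
      1 / (2 ^ n * (n.factorial : ℂ) * (2 * Real.pi * Complex.I) ^ n) *
        torusIntegral (formIntegrand β f g) 0 1 := rfl

/-- The form as a linear map in its first argument. -/
def formLeft {n : ℕ} {β : ℂ} (hβ : ‖β‖ < 1) (g : Laurent n) : Laurent n →ₗ[ℂ] ℂ where
  toFun f := koornwinderForm 0 0 ![-β, 0, 0, 0] f g
  map_add' f f' := by
    rw [koornwinderForm_eq, koornwinderForm_eq, koornwinderForm_eq, ← mul_add,
      ← torusIntegral_add (torusIntegrable_formIntegrand hβ f g)
        (torusIntegrable_formIntegrand hβ f' g)]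
    congr 2
    funext z
    simp only [formIntegrand, Laurent.eval_add]
    ring
  map_smul' c f := by
    rw [koornwinderForm_eq, koornwinderForm_eq, RingHom.id_apply, smul_eq_mul, mul_left_comm,
      ← smul_eq_mul c, ← torusIntegral_smul]
    congr 2
    funext z
    simp only [formIntegrand, Laurent.eval_smul, smul_eq_mul]
    ring

/-! ### Orthonormality of the interpolating polynomials -/

theorem strictAnti_add_sub {n : ℕ} {a : Fin n → ℤ} (ha : Antitone a) :
    StrictAnti fun i : Fin n => a i + n - i := by
  intro i j hij
  have h1 := ha hij.le
  have h2 : (i : ℕ) < j := hij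
  simp only
  omega

/-- The two Weyl denominators in the density clear those of the polynomials. Expanding the two
remaining determinants over permutations leaves products of one-variable integrals. -/
theorem koornwinderForm_transLaurent {n : ℕ} {a b : Fin n → ℤ} (ha : Antitone a)
    (ha0 : ∀ i, 0 ≤ a i) (hb : Antitone b) (hb0 : ∀ i, 0 ≤ b i)
    (hpa : IsPartition (halfShift 0 a)) (hpb : IsPartition (halfShift 0 b)) {β : ℂ}
    (hβ : ‖β‖ < 1) :
    koornwinderForm 0 0 ![-β, 0, 0, 0] (transLaurent (halfShift 0 a) β)
      (transLaurent (halfShift 0 b) β) = if a = b then 1 else 0 := by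
  let A : Fin n → ℤ := fun i => a i + n - i
  let B : Fin n → ℤ := fun i => b i + n - i
  have hA : StrictAnti A := strictAnti_add_sub ha
  have hB : StrictAnti B := strictAnti_add_sub hb
  have hA1 : ∀ i, 1 ≤ A i := fun i => by
    have h1 := ha0 i
    have h2 := i.isLt
    simp only [A]; omega
  have hB1 : ∀ i, 1 ≤ B i := fun i => by
    have h1 := hb0 i
    have h2 := i.isLt
    simp only [B]; omega
  let h : ℤ → ℤ → ℂ → ℂ := fun l m w =>
    circleFun β l w * circleFun β m w⁻¹ / ((1 + β * w) * (1 + β * w⁻¹)) * w⁻¹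
  let sg : Equiv.Perm (Fin n) → ℂ := fun σ => ((Equiv.Perm.sign σ : ℤ) : ℂ)
  have hint : torusIntegral (formIntegrand β (transLaurent (halfShift 0 a) β)
      (transLaurent (halfShift 0 b) β)) 0 1 =
      ∑ σ : Equiv.Perm (Fin n), ∑ τ : Equiv.Perm (Fin n), sg σ * sg τ *
        ∏ i, if A (σ i) = B (τ i) then 2 * (2 * Real.pi * Complex.I) else 0 := by
    have h1 : torusIntegral (formIntegrand β (transLaurent (halfShift 0 a) β)
        (transLaurent (halfShift 0 b) β)) 0 1 =
        torusIntegral (fun z => ∑ p ∈ (Finset.univ : Finset (Equiv.Perm (Fin n))) ×ˢ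
          (Finset.univ : Finset (Equiv.Perm (Fin n))),
          (sg p.1 * sg p.2) • ∏ i, h (A (p.1 i)) (B (p.2 i)) (z i)) 0 1 := by
      refine torusIntegral_congr fun z hz => ?_
      have hz0 : ∀ i, z i ≠ 0 := fun i h => by simpa [h] using hz i
      have e1 := eval_transLaurent_mul_weylDenom ha ha0 hpa hβ hz
      have e2 := eval_transLaurent_mul_weylDenom hb hb0 hpb hβ (z := fun i => (z i)⁻¹)
        fun i => by simp [hz i]
      have e3 : formIntegrand β (transLaurent (halfShift 0 a) β)
          (transLaurent (halfShift 0 b) β) z =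
          (Matrix.of fun i j : Fin n => circleFun β (A i) (z j)).det *
          (Matrix.of fun i j : Fin n => circleFun β (B i) (z j)⁻¹).det *
          ((∏ i, ((1 + β * z i) * (1 + β * (z i)⁻¹))⁻¹) * ∏ i, (z i)⁻¹) := by
        rw [formIntegrand, koornwinderDensity_eq_weylDenom β hz0, ← e1, ← e2]
        ring
      rw [e3, Matrix.det_apply', Matrix.det_apply', Finset.sum_mul_sum, Finset.sum_product,
        Finset.sum_mul]
      refine Finset.sum_congr rfl fun σ _ => ?_
      rw [Finset.sum_mul]
      refine Finset.sum_congr rfl fun τ _ => ?_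
      simp only [h, div_eq_mul_inv, Finset.prod_mul_distrib, Matrix.of_apply, sg, smul_eq_mul]
      ring
    rw [h1, torusIntegral_finset_sum, Finset.sum_product]
    · refine Finset.sum_congr rfl fun σ _ => Finset.sum_congr rfl fun τ _ => ?_
      rw [torusIntegral_smul, torusIntegral_prod (fun i => h (A (σ i)) (B (τ i))), smul_eq_mul]
      congr 1
      exact Finset.prod_congr rfl fun i _ => circleIntegral_circleFun_mul hβ (hA1 _) (hB1 _)
    · intro p _
      simp only [smul_eq_mul]
      refine torusIntegrable_of_continuousOn (continuousOn_const.mul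
        (continuousOn_finsetProd _ fun i _ => ?_))
      have hi := continuousOn_inv_coord i
      have hc : ContinuousOn (fun z : Fin n → ℂ => z i) {z | ∀ i, ‖z i‖ = 1} :=
        (continuous_apply i).continuousOn
      have hne : ∀ z ∈ {z : Fin n → ℂ | ∀ i, ‖z i‖ = 1}, z i ≠ 0 := fun z hz h => by
        simpa [h] using hz i
      have hcf : ∀ (k : ℤ) (u : (Fin n → ℂ) → ℂ), ContinuousOn u {z | ∀ i, ‖z i‖ = 1} →
          (∀ z ∈ {z : Fin n → ℂ | ∀ i, ‖z i‖ = 1}, u z ≠ 0) →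
          ContinuousOn (fun z => circleFun β k (u z)) {z | ∀ i, ‖z i‖ = 1} := by
        intro k u hu hu0
        have hz : ∀ k : ℤ, ContinuousOn (fun z => u z ^ k) {z | ∀ i, ‖z i‖ = 1} := fun k =>
          hu.zpow₀ k fun z hz => Or.inl (hu0 z hz)
        exact ((hz _).sub (hz _)).add (continuousOn_const.mul ((hz _).sub (hz _)))
      refine ContinuousOn.mul (ContinuousOn.div ((hcf _ _ hc hne).mul
        (hcf _ _ hi fun z hz => inv_ne_zero (hne z hz))) ?_ ?_) hi
      · exact (continuousOn_const.add (continuousOn_const.mul hc)).mul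
          (continuousOn_const.add (continuousOn_const.mul hi))
      · intro z hz
        exact mul_ne_zero (one_add_mul_ne_zero hβ (hz i).le)
          (one_add_mul_ne_zero hβ (by simp [hz i]))
  rw [koornwinderForm_eq, hint]
  split_ifs with hab
  · subst hab
    -- Injectivity of `A` leaves only `τ = σ`, so the double sum is `n! (2 · 2πi)^n`, which the
    -- normalization of the form turns into `1`.
    have h1 : ∀ σ : Equiv.Perm (Fin n), (∑ τ : Equiv.Perm (Fin n), sg σ * sg τ *
        ∏ i, if A (σ i) = B (τ i) then 2 * (2 * Real.pi * Complex.I) else 0) =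
        (2 * (2 * Real.pi * Complex.I)) ^ n := by
      intro σ
      rw [Finset.sum_eq_single σ]
      · have : sg σ * sg σ = 1 := by
          simp only [sg]
          rw [← Int.cast_mul, ← Units.val_mul, Int.units_mul_self]; simp
        rw [this, one_mul]
        simp [A, B]
      · intro τ _ hne
        obtain ⟨i, hi⟩ : ∃ i, σ i ≠ τ i := by
          by_contra! hall
          exact hne (Equiv.ext fun i => (hall i).symm)
        rw [Finset.prod_eq_zero (Finset.mem_univ i), mul_zero]
        rw [if_neg]
        exact fun he => hi (hA.injective he)
      · intro hn; exact absurd (Finset.mem_univ _) hn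
    rw [Finset.sum_congr rfl fun σ _ => h1 σ, Finset.sum_const, Finset.card_univ,
      Fintype.card_perm, Fintype.card_fin, nsmul_eq_mul]
    have h2 : (n.factorial : ℂ) ≠ 0 := by exact_mod_cast n.factorial_ne_zero
    have h3 : (2 * Real.pi * Complex.I : ℂ) ≠ 0 := Complex.two_pi_I_ne_zero
    generalize (2 * Real.pi * Complex.I : ℂ) = w at h3 ⊢
    rw [mul_pow]
    field_simp
  · rw [Finset.sum_eq_zero, mul_zero]
    refine fun σ _ => Finset.sum_eq_zero fun τ _ => ?_
    obtain ⟨i, hi⟩ : ∃ i, A (σ i) ≠ B (τ i) := by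
      by_contra! hall
      apply hab
      -- Strictly decreasing sequences with the same range are equal.
      have h1 : A = B := by
        rw [← hA.range_inj hB, ← σ.surjective.range_comp A, ← τ.surjective.range_comp B]
        exact congrArg Set.range (funext hall)
      funext i
      have := congrFun h1 i
      simp only [A, B] at this
      omega
    rw [Finset.prod_eq_zero (Finset.mem_univ i) (if_neg hi), mul_zero]

/-! ### Dominance order -/

namespace NPartition
variable {n : ℕ}

theorem toRat_eq_halfShift (lam : NPartition n) : lam.toRat = halfShift 0 lam.1 := by
  funext i; simp [toRat, halfShift]

theorem antitone (lam : NPartition n) : Antitone lam.1 := fun i j hij => by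
  have h : (lam.1 j : ℚ) ≤ lam.1 i := lam.2.1 hij
  exact_mod_cast h

theorem isPartition_toRat (lam : NPartition n) : IsPartition lam.toRat := lam.2

theorem nonneg (lam : NPartition n) (i : Fin n) : 0 ≤ lam.1 i := by
  obtain ⟨m, hm⟩ := lam.2.2 i
  have h : (lam.1 i : ℚ) = m := hm
  have : lam.1 i = m := by exact_mod_cast h
  omega

/-- The sum of the partial sums of a partition. -/
def rank (lam : NPartition n) : ℤ := ∑ k : Fin n, ∑ i ∈ Finset.Iic k, lam.1 i

theorem rank_nonneg (lam : NPartition n) : 0 ≤ lam.rank :=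
  Finset.sum_nonneg fun _ _ => Finset.sum_nonneg fun i _ => lam.nonneg i

theorem Dominated.trans {a b c : NPartition n} (h : a.Dominated b) (h' : b.Dominated c) :
    a.Dominated c := fun k => (h k).trans (h' k)

theorem Dominated.rank_le {a b : NPartition n} (h : a.Dominated b) : a.rank ≤ b.rank :=
  Finset.sum_le_sum fun k _ => h k

/-- The rank is the sum of the quantities compared by dominance, so equal ranks force equal partial
sums. Rank thus strictly increases along dominance and can serve for induction. -/
theorem Dominated.eq_of_rank_eq {a b : NPartition n} (h : a.Dominated b) (hr : a.rank = b.rank) :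
    a = b := by
  have h1 : ∀ k, ∑ i ∈ Finset.Iic k, a.1 i = ∑ i ∈ Finset.Iic k, b.1 i := fun k =>
    (Finset.sum_eq_sum_iff_of_le fun k _ => h k).1 hr k (Finset.mem_univ k)
  refine Subtype.ext (funext fun k => ?_)
  have h2 : ∀ v : Fin n → ℤ, ∑ i ∈ Finset.Iic k, v i = v k + ∑ i ∈ Finset.Iio k, v i := fun v => by
    rw [← Finset.Iio_insert, Finset.sum_insert (by simp)]
  have h3 : ∑ i ∈ Finset.Iio k, a.1 i = ∑ i ∈ Finset.Iio k, b.1 i := by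
    by_cases hk : (k : ℕ) = 0
    · have : Finset.Iio k = ∅ := by
        ext i; simp only [Finset.mem_Iio, Fin.lt_def, Finset.notMem_empty, iff_false]; omega
      rw [this, Finset.sum_empty, Finset.sum_empty]
    · have : Finset.Iio k = Finset.Iic ⟨k - 1, by omega⟩ := by
        ext i; simp only [Finset.mem_Iio, Finset.mem_Iic, Fin.lt_def, Fin.le_def]; omega
      rw [this]
      exact h1 _
  have h4 := h1 k
  rw [h2, h2, h3] at h4
  exact add_right_cancel h4

theorem Dominated.rank_lt {a b : NPartition n} (h : a.Dominated b) (hne : a ≠ b) :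
    a.rank < b.rank :=
  lt_of_le_of_ne h.rank_le fun hr => hne (h.eq_of_rank_eq hr)

end NPartition

/-! ### Invariant Laurent polynomials -/

section invariant
variable {n : ℕ}

theorem IsBCInvariant.coeff_abs {f : Laurent n} (hf : IsBCInvariant f) (a : Fin n → ℤ) :
    f.coeff (fun i => |a i|) = f.coeff a := by
  have h : ∀ s : Finset (Fin n), f.coeff (fun i => if i ∈ s then |a i| else a i) = f.coeff a := by
    intro s
    induction s using Finset.induction_on with
    | empty => simp
    | insert i s hi ih =>
      rcases abs_choice (a i) with h | h
      · rw [← ih]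
        congr 1
        funext j
        by_cases hj : j = i
        · subst hj; simp [h]
        · simp [hj]
      · rw [← ih, ← hf.2 i]
        congr 1
        funext j
        by_cases hj : j = i
        · subst hj; simp [h, hi]
        · simp [hj]
  simpa using h Finset.univ

/-- Every exponent can be moved to a partition by taking absolute values and sorting, so the
coefficients at partitions determine an invariant polynomial. -/
theorem IsBCInvariant.eq_zero {f : Laurent n} (hf : IsBCInvariant f)
    (h : ∀ mu : NPartition n, f.coeff mu.1 = 0) : f = 0 := by
  ext a
  rw [← hf.coeff_abs]
  let b : Fin n → ℤ := fun i => |a i|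
  let σ := Tuple.sort fun i => -b i
  have hσ : Monotone ((fun i => -b i) ∘ σ) := Tuple.monotone_sort _
  have h1 : Antitone (b ∘ σ) := fun i j hij => by
    have := hσ hij
    simp only [Function.comp_apply] at this ⊢
    linarith
  have h2 : IsPartition fun i => ((b ∘ σ) i : ℚ) := by
    refine ⟨fun i j hij => by
      change ((b ∘ σ) j : ℚ) ≤ (b ∘ σ) i
      exact_mod_cast h1 hij, fun i => ⟨(a (σ i)).natAbs, ?_⟩⟩
    simp [b, Nat.cast_natAbs]
  have h3 := h ⟨b ∘ σ, h2⟩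
  rw [hf.1 σ b] at h3
  simpa using h3

theorem isBCInvariant_sub {f g : Laurent n} (hf : IsBCInvariant f) (hg : IsBCInvariant g) :
    IsBCInvariant (f - g) :=
  ⟨fun σ a => by simp [hf.1 σ a, hg.1 σ a], fun i a => by simp [hf.2 i a, hg.2 i a]⟩

theorem isBCInvariant_sum_smul {ι : Type*} (s : Finset ι) (c : ι → ℂ) {g : ι → Laurent n}
    (hg : ∀ i, IsBCInvariant (g i)) : IsBCInvariant (∑ i ∈ s, c i • g i) := by
  refine ⟨fun σ a => ?_, fun i a => ?_⟩
  · simp [AddMonoidAlgebra.coeff_sum, (hg _).1 σ a]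
  · simp [AddMonoidAlgebra.coeff_sum, (hg _).2 i a]

/-- Invariant Laurent polynomials with exponents in a lower set of partitions are spanned by the
members of a unitriangular family in this lower set. -/
theorem mem_span_of_isBCInvariant {T : NPartition n → Laurent n}
    (hT : ∀ lam, IsBCInvariant (T lam))
    (htri : ∀ lam mu : NPartition n, ¬ mu.Dominated lam → (T lam).coeff mu.1 = 0)
    (hlead : ∀ lam : NPartition n, (T lam).coeff lam.1 = 1) {D : Set (NPartition n)}
    (hD : ∀ mu nu, nu.Dominated mu → mu ∈ D → nu ∈ D) (N : ℕ) (f : Laurent n)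
    (hf : IsBCInvariant f) (hfD : ∀ mu, f.coeff mu.1 ≠ 0 → mu ∈ D ∧ mu.rank < N) :
    f ∈ Submodule.span ℂ (T '' D) := by
  classical
  induction N generalizing f with
  | zero =>
    have : f = 0 := hf.eq_zero fun mu => by
      by_contra h
      have := (hfD mu h).2
      have := mu.rank_nonneg
      push_cast at *
      omega
    rw [this]
    exact Submodule.zero_mem _
  | succ N ih =>
    -- The partitions of top rank `N` in `f`; subtracting the matching multiples of `T mu` lowers
    -- the rank bound.
    let S : Finset (NPartition n) :=
      (f.coeff.support.preimage (fun mu : NPartition n => mu.1)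
        fun _ _ _ _ h => Subtype.ext h).filter fun mu => mu.rank = N
    have hS : ∀ mu : NPartition n, mu ∈ S ↔ f.coeff mu.1 ≠ 0 ∧ mu.rank = N := fun mu => by
      exact Finset.mem_filter.trans
        (and_congr (Finset.mem_preimage.trans Finsupp.mem_support_iff) Iff.rfl)
    let g : Laurent n := ∑ mu ∈ S, f.coeff mu.1 • T mu
    have hg : g ∈ Submodule.span ℂ (T '' D) := Submodule.sum_mem _ fun mu hmu =>
      Submodule.smul_mem _ _
        (Submodule.subset_span ⟨mu, (hfD mu ((hS mu).1 hmu).1).1, rfl⟩)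
    have hgc : ∀ a, g.coeff a = ∑ mu ∈ S, f.coeff mu.1 * (T mu).coeff a := fun a => by
      simp [g, AddMonoidAlgebra.coeff_sum]
    rw [← sub_add_cancel f g]
    refine Submodule.add_mem _ (ih _ (isBCInvariant_sub hf (isBCInvariant_sum_smul S _ hT)) ?_) hg
    intro nu hnu
    rw [AddMonoidAlgebra.coeff_sub, Finsupp.sub_apply, hgc] at hnu
    -- An exponent surviving in `f - g` is either strictly dominated by some member of `S`, hence of
    -- smaller rank, or it already occurs in `f` outside `S`.
    by_cases hex : ∃ mu ∈ S, nu.Dominated mu ∧ nu ≠ mu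
    · obtain ⟨mu, hmu, hd, hne⟩ := hex
      have h1 := (hS mu).1 hmu
      refine ⟨hD mu nu hd (hfD mu h1.1).1, ?_⟩
      have := hd.rank_lt hne
      omega
    · push Not at hex
      have h0 : ∀ mu ∈ S, mu ≠ nu → f.coeff mu.1 * (T mu).coeff nu.1 = 0 := fun mu hmu hne => by
        rw [htri mu nu fun hd => hne (hex mu hmu hd).symm, mul_zero]
      by_cases hnuS : nu ∈ S
      · rw [Finset.sum_eq_single_of_mem nu hnuS h0, hlead, mul_one, sub_self] at hnu
        exact absurd rfl hnu
      · rw [Finset.sum_eq_zero fun mu hmu => h0 mu hmu fun h => hnuS (h ▸ hmu), sub_zero] at hnu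
        have h1 := hfD nu hnu
        refine ⟨h1.1, ?_⟩
        have h2 : nu.rank ≠ N := fun h => hnuS ((hS nu).2 ⟨hnu, h⟩)
        have h3 := h1.2
        push_cast at h3
        omega

end invariant

/-! ### The Koornwinder family -/

section family
variable {n : ℕ} {β : ℂ}

theorem koornwinderForm_transLaurent_toRat (hβ : ‖β‖ < 1) (lam mu : NPartition n) :
    koornwinderForm 0 0 ![-β, 0, 0, 0] (transLaurent lam.toRat β) (transLaurent mu.toRat β) =
      if lam.1 = mu.1 then 1 else 0 := by
  rw [lam.toRat_eq_halfShift, mu.toRat_eq_halfShift]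
  exact koornwinderForm_transLaurent lam.antitone lam.nonneg mu.antitone mu.nonneg
    (lam.toRat_eq_halfShift ▸ lam.2) (mu.toRat_eq_halfShift ▸ mu.2) hβ

theorem isKoornwinderFamily_transLaurent (hβ : ‖β‖ < 1) :
    IsKoornwinderFamily 0 0 ![-β, 0, 0, 0] fun lam : NPartition n => transLaurent lam.toRat β where
  invariant lam := isBCInvariant_transLaurent lam.2 β
  orthogonal lam mu hne := by
    rw [koornwinderForm_transLaurent_toRat hβ, if_neg fun h => hne (Subtype.ext h)]
  triangular lam mu h := by
    obtain ⟨k, hk⟩ := not_forall.1 h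
    rw [coeff_transLaurent lam.isPartition_toRat]
    refine coeff_transCB_eq_zero (k := k) β ?_
    simp only [NPartition.toRat, ratExponent]
    exact_mod_cast not_le.1 hk
  leading lam := by
    rw [coeff_transLaurent lam.isPartition_toRat]
    exact coeff_transCB_self lam.isPartition_toRat β

/-- By induction on rank, `K lam - T lam` lies in the span of the `T mu` with `mu` strictly below
`lam` and pairs to zero with each of them. Since `⟨T mu, T mu⟩ = 1`, all its coefficients in this
span vanish; no positivity of the form is involved, which matters because `β` is complex. -/
theorem IsKoornwinderFamily.eq_transLaurent (hβ : ‖β‖ < 1) {K : NPartition n → Laurent n}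
    (hK : IsKoornwinderFamily 0 0 ![-β, 0, 0, 0] K) (lam : NPartition n) :
    K lam = transLaurent lam.toRat β := by
  let T : NPartition n → Laurent n := fun lam => transLaurent lam.toRat β
  have hT : IsKoornwinderFamily 0 0 ![-β, 0, 0, 0] T := isKoornwinderFamily_transLaurent hβ
  suffices h : ∀ (N : ℕ) (lam : NPartition n), lam.rank < N → K lam = T lam by
    exact h (lam.rank.toNat + 1) lam (by have := lam.rank_nonneg; push_cast; omega)
  intro N
  induction N with
  | zero =>
    intro lam h
    have := lam.rank_nonneg
    push_cast at h
    omega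
  | succ N ih =>
    intro lam hlam
    let D : Set (NPartition n) := {mu | mu.Dominated lam ∧ mu ≠ lam}
    let f : Laurent n := K lam - T lam
    have hD : ∀ mu nu : NPartition n, nu.Dominated mu → mu ∈ D → nu ∈ D := by
      rintro mu nu h ⟨h1, h2⟩
      refine ⟨h.trans h1, ?_⟩
      rintro rfl
      exact h2 (h1.eq_of_rank_eq (le_antisymm h1.rank_le h.rank_le))
    have hfD : ∀ mu : NPartition n, f.coeff mu.1 ≠ 0 → mu ∈ D := by
      intro mu hmu
      simp only [f, AddMonoidAlgebra.coeff_sub, Finsupp.sub_apply] at hmu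
      refine ⟨?_, ?_⟩
      · by_contra h
        rw [hK.triangular lam mu h, hT.triangular lam mu h, sub_zero] at hmu
        exact hmu rfl
      · rintro rfl
        rw [hK.leading, hT.leading, sub_self] at hmu
        exact hmu rfl
    have hspan : f ∈ Submodule.span ℂ (T '' D) :=
      mem_span_of_isBCInvariant hT.invariant hT.triangular hT.leading hD (N + 1) f
        (isBCInvariant_sub (hK.invariant lam) (hT.invariant lam)) fun mu hmu =>
          ⟨hfD mu hmu, ((hfD mu hmu).1.rank_le).trans_lt hlam⟩
    have horth : ∀ mu ∈ D, formLeft hβ (T mu) f = 0 := by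
      rintro mu ⟨h1, h2⟩
      -- The induction hypothesis turns orthogonality of `K lam` to `K mu` into orthogonality to `T
      -- mu`.
      have hmu : K mu = T mu := ih mu (by
        have := h1.rank_lt h2
        push_cast at hlam
        omega)
      have e1 : formLeft hβ (T mu) (K lam) = 0 := by
        rw [← hmu]; exact hK.orthogonal lam mu h2.symm
      have e2 : formLeft hβ (T mu) (T lam) = 0 := hT.orthogonal lam mu h2.symm
      rw [map_sub, e1, e2, sub_zero]
    obtain ⟨c, hc, hcf⟩ := (Finsupp.mem_span_image_iff_linearCombination ℂ).1 hspan
    have hc0 : c = 0 := by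
      ext mu
      by_cases hmu : mu ∈ D
      · have h1 := horth mu hmu
        rw [← hcf, Finsupp.linearCombination_apply, Finsupp.sum, map_sum] at h1
        have h2 : ∀ nu ∈ c.support, nu ≠ mu → formLeft hβ (T mu) (c nu • T nu) = 0 := by
          intro nu _ hne
          have : formLeft hβ (T mu) (T nu) = 0 := hT.orthogonal nu mu hne
          rw [map_smul, this, smul_zero]
        have h3 : formLeft hβ (T mu) (T mu) = 1 :=
          (koornwinderForm_transLaurent_toRat hβ mu mu).trans (if_pos rfl)
        rw [Finset.sum_eq_single mu h2 fun h => by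
          rw [Finsupp.notMem_support_iff.1 h, zero_smul, map_zero], map_smul, h3] at h1
        simpa using h1
      · by_contra h
        exact hmu (hc (Finsupp.mem_support_iff.2 h))
    rw [hc0, map_zero] at hcf
    exact sub_eq_zero.1 hcf.symm

end family

end CBInterp

end

theorem mainTheorem4 (n : ℕ) :
    (CBInterp.denomMatrix n).det ≠ 0 ∧
    (∀ (lam : Fin n → ℚ) (β : ℂ), CBInterp.IsPartition lam →
      CBInterp.toFrac (CBInterp.transCB lam β) =
        CBInterp.toFrac (CBInterp.numMatrix lam β).det /
          CBInterp.toFrac (CBInterp.denomMatrix n).det) ∧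
    (∀ (lam : Fin n → ℚ) (β : ℂ), CBInterp.IsHalfPartition lam →
      CBInterp.toFrac (CBInterp.transCB lam β) =
        CBInterp.toFrac (CBInterp.halfNumMatrix lam β).det /
          CBInterp.toFrac (CBInterp.denomMatrix n).det) ∧
    (∀ β : ℂ, ‖β‖ < 1 →
      (∃! K : CBInterp.NPartition n → CBInterp.Laurent n,
        CBInterp.IsKoornwinderFamily 0 0 ![-β, 0, 0, 0] K) ∧
      ∀ K : CBInterp.NPartition n → CBInterp.Laurent n,
        CBInterp.IsKoornwinderFamily 0 0 ![-β, 0, 0, 0] K →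
          ∀ lam : CBInterp.NPartition n,
            (K lam).toFracLaurent = CBInterp.transCB lam.toRat β) := by
  refine ⟨?_, fun lam β h => CBInterp.toFrac_transCB_of_isPartition β h,
    fun lam β h => CBInterp.toFrac_transCB_of_isHalfPartition β h, fun β hβ => ⟨?_, ?_⟩⟩
  · rw [CBInterp.det_denomMatrix]
    exact CBInterp.weylDenom_xpow_ne_zero n
  · exact ⟨_, CBInterp.isKoornwinderFamily_transLaurent hβ,
      fun K hK => funext fun lam => hK.eq_transLaurent hβ lam⟩
  · intro K hK lam
    rw [hK.eq_transLaurent hβ lam]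
    exact CBInterp.toFracLaurent_transLaurent lam.2 β
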